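/- Conventions. For $k\ge 1$, a $k$-graph $H$ consists of a finite vertex set $V(H)$ and a set of $k$-element subsets of $V(H)$, called edges. For $0\le \ell\le k-1$, $\delta_\ell(H)$ is the minimum, over all $\ell$-element sets $S\subseteq V(H)$, of the number of edges containing $S$. Let $F$ be an $m$-vertex $k$-graph with $m\ge 1$. A copy of $F$ in $H$ is a (not necessarily induced) subgraph of $H$ isomorphic to $F$. An $F$-packing in $H$ is a collection $M$ of pairwise vertex-disjoint copies of $F$ in $H$; $V(M)$ is the set of vertices it covers, and $M$ is perfect if $V(M)=V(H)$. For $D\in\mathbb N$, $\delta(F,\ell,D)$ is the smallest $\delta\ge 0$ such that for every $\varepsilon>0$, every $k$-graph $H$ on sufficiently many vertices $n$ with $\delta_\ell(H)\ge(\delta+\varepsilon)\binom{n-\ell}{k-\ell}$ has an $F$-packing covering all but at most $D$ vertices. Let $H$ be a $k$-graph on $n$ vertices and let $\mathcal P=(V_1,\dots,V_d)$ be an ordered partition of $V(H)$ into nonempty parts. The index vector of $S\subseteq V(H)$ is $\mathbf i_{\mathcal P}(S)=(|S\cap V_1|,\dots,|S\cap V_d|)\in\mathbb Z^d$. For $\mu>0$,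 $L^\mu_{\mathcal P,F}(H)$ is the subgroup of $\mathbb Z^d$ generated by all $\mathbf i\in\mathbb Z^d$ such that $H$ contains at least $\mu n^m$ copies of $F$ whose vertex set has index vector $\mathbf i$. Let $L^d_{\max}=\{\mathbf v\in\mathbb Z^d : m \text{ divides } v_1+\dots+v_d\}$. For a subgroup $L\subseteq L^d_{\max}$, the coset group is $Q(\mathcal P,L)=L^d_{\max}/L$. The pair $(\mathcal P,L)$ is $q$-soluble if there is a (possibly empty) $F$-packing $M$ in $H$ of size at most $q$ with $\mathbf i_{\mathcal P}(V(H)\setminus V(M))\in L$. Vertices $u,v\in V(H)$ are $(F,\beta,t)$-reachable if there are at least $\beta n^{tm-1}$ sets $S\subseteq V(H)$ of size $tm-1$ such that both $H[S\cup\{u\}]$ and $H[S\cup\{v\}]$ have perfect $F$-packings. The partition $\mathcal P$ is $(F,\beta,t,c)$-good if for every $i$ any two distinct vertices of $V_i$ are $(F,\beta,t)$-reachable and $|V_i|\ge cn$. Theorem. For all integers $m,D,q,t\ge 1$ and reals $\gamma,c>0$ there is $\varepsilon_0>0$ such that for all $\beta,\mu\in(0,\varepsilon_0]$ there is $n_0\in\mathbb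 N$ with the following property. Let $k,\ell$ be integers with $0\le\ell\le k-1$, let $F$ be an $m$-vertex $k$-graph, and let $H$ be a $k$-graph on $n\ge n_0$ vertices, where $m$ divides $n$. Suppose that (i) $\delta_\ell(H)\ge(\delta(F,\ell,D)+\gamma)\binom{n-\ell}{k-\ell}$; (ii) $\mathcal P=(V_1,\dots,V_d)$ is an $(F,\beta,t,c)$-good partition of $V(H)$; (iii) $|Q(\mathcal P,L^\mu_{\mathcal P,F}(H))|\le q$. Then $H$ has a perfect $F$-packing if and only if $(\mathcal P,L^\mu_{\mathcal P,F}(H))$ is $q$-soluble. -/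

import Mathlib

namespace Hypergraph

/-- `H` is a (finite) `k`-graph: its vertex set is finite and all its edges are `k`-element sets. -/
def IsKGraph {α : Type*} (k : ℕ) (H : Hypergraph α) : Prop :=
  H.vertexSet.Finite ∧ ∀ e ∈ H.edgeSet, e.ncard = k

/-- The number of edges of `H` that contain `S`. -/
noncomputable def setDegree {α : Type*} (H : Hypergraph α) (S : Set α) : ℕ :=
  {e | e ∈ H.edgeSet ∧ S ⊆ e}.ncard

/-- The minimum `ℓ`-degree of `H`: the minimum of `setDegree H S` over all `ℓ`-element sets `S` of
vertices. -/
noncomputable def minDegree {α : Type*} (ℓ : ℕ) (H : Hypergraph α) : ℕ :=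
  sInf (H.setDegree '' {S | S ⊆ H.vertexSet ∧ S.ncard = ℓ})

/-- The sub-hypergraph `H[S]` induced by a set `S` of vertices. -/
def induce {α : Type*} (H : Hypergraph α) (S : Set α) : Hypergraph α where
  vertexSet := H.vertexSet ∩ S
  edgeSet := {e | e ∈ H.edgeSet ∧ e ⊆ S}
  subset_vertexSet_of_mem_edgeSet' := fun _ he =>
    Set.subset_inter (H.subset_vertexSet_of_mem_edgeSet' he.1) he.2

/-- `G` is a copy of `F` in `H`: a (not necessarily induced) sub-hypergraph of `H` that is
isomorphic to `F`, that is, the image of `F` under a map injective on the vertices of `F`. -/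
def IsCopyIn {β α : Type*} (F : Hypergraph β) (H G : Hypergraph α) : Prop :=
  G.vertexSet ⊆ H.vertexSet ∧ G.edgeSet ⊆ H.edgeSet ∧
    ∃ f : β → α, Set.InjOn f F.vertexSet ∧ G = F.image f

/-- An `F`-packing in `H`: a collection of pairwise vertex-disjoint copies of `F` in `H`. -/
def IsPacking {β α : Type*} (F : Hypergraph β) (H : Hypergraph α)
    (M : Finset (Hypergraph α)) : Prop :=
  (∀ G ∈ M, IsCopyIn F H G) ∧
    (M : Set (Hypergraph α)).PairwiseDisjoint Hypergraph.vertexSet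

/-- The set `V(M)` of vertices covered by a collection `M` of hypergraphs. -/
def covered {α : Type*} (M : Finset (Hypergraph α)) : Set α :=
  ⋃ G ∈ M, G.vertexSet

/-- `H` has a perfect `F`-packing. -/
def HasPerfectPacking {β α : Type*} (F : Hypergraph β) (H : Hypergraph α) : Prop :=
  ∃ M : Finset (Hypergraph α), IsPacking F H M ∧ covered M = H.vertexSet

/-- Every `k`-graph `H` on `n` vertices with `δ_ℓ(H) ≥ (δ + o(1)) * C(n - ℓ, k - ℓ)` contains an
`F`-packing covering all but at most `D` vertices. -/
def ForcesAlmostPacking {β : Type*} (k : ℕ) (F : Hypergraph β) (ℓ D : ℕ) (δ : ℝ) : Prop :=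
  ∀ ε : ℝ, 0 < ε → ∃ n₀ : ℕ, ∀ (α : Type) (H : Hypergraph α), H.IsKGraph k →
    n₀ ≤ H.vertexSet.ncard →
    (δ + ε) * ((H.vertexSet.ncard - ℓ).choose (k - ℓ) : ℝ) ≤ (H.minDegree ℓ : ℝ) →
    ∃ M : Finset (Hypergraph α), IsPacking F H M ∧ (H.vertexSet \ covered M).ncard ≤ D

/-- The threshold `δ(F, ℓ, D)`: the smallest `δ ≥ 0` with the property above. -/
noncomputable def almostPackingThreshold {β : Type*} (k : ℕ) (F : Hypergraph β) (ℓ D : ℕ) : ℝ :=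
  sInf {δ : ℝ | 0 ≤ δ ∧ ForcesAlmostPacking k F ℓ D δ}

/-- `P 0, …, P (d - 1)` is an (ordered) partition of the set `X` into nonempty parts. -/
def IsOrderedPartition {α : Type*} {d : ℕ} (P : Fin d → Set α) (X : Set α) : Prop :=
  (∀ i, (P i).Nonempty) ∧ Pairwise (fun i j => Disjoint (P i) (P j)) ∧ ⋃ i, P i = X

/-- The index vector of `S` with respect to the parts `P`. -/
noncomputable def indexVector {α : Type*} {d : ℕ} (P : Fin d → Set α) (S : Set α) : Fin d → ℤ :=
  fun i => ((S ∩ P i).ncard : ℤ)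

/-- The set of all vectors `v` such that `H` contains at least `μ * n ^ m` copies of `F` with index
vector `v`, where `n` and `m` are the numbers of vertices of `H` and `F`. -/
def robustIndexVectors {β α : Type*} (F : Hypergraph β) (H : Hypergraph α) {d : ℕ}
    (P : Fin d → Set α) (μ : ℝ) : Set (Fin d → ℤ) :=
  {v | μ * (H.vertexSet.ncard : ℝ) ^ F.vertexSet.ncard ≤
    ({G | IsCopyIn F H G ∧ indexVector P G.vertexSet = v}.ncard : ℝ)}

/-- The lattice generated by the robust index vectors. -/
def robustLattice {β α : Type*} (F : Hypergraph β) (H : Hypergraph α) {d : ℕ}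
    (P : Fin d → Set α) (μ : ℝ) : AddSubgroup (Fin d → ℤ) :=
  AddSubgroup.closure (robustIndexVectors F H P μ)

/-- The lattice of all integer vectors whose coordinate sum is divisible by `m`. -/
def maxLattice (d m : ℕ) : AddSubgroup (Fin d → ℤ) where
  carrier := {v | (m : ℤ) ∣ ∑ i, v i}
  add_mem' := fun {a b} ha hb => by
    simpa [Finset.sum_add_distrib] using dvd_add ha hb
  zero_mem' := by simp
  neg_mem' := fun {a} ha => by simpa using ha

/-- The coset group `maxLattice d m / L`; it is used for lattices `L` contained in
`maxLattice d m`. -/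
abbrev CosetGroup {d : ℕ} (m : ℕ) (L : AddSubgroup (Fin d → ℤ)) : Type :=
  maxLattice d m ⧸ L.addSubgroupOf (maxLattice d m)

/-- `(P, L)` is `q`-soluble: some `F`-packing `M` in `H` of size at most `q` is such that the index
vector of `V(H) \ V(M)` lies in `L`. -/
def IsSoluble {β α : Type*} (F : Hypergraph β) (H : Hypergraph α) {d : ℕ}
    (P : Fin d → Set α) (L : AddSubgroup (Fin d → ℤ)) (q : ℕ) : Prop :=
  ∃ M : Finset (Hypergraph α), IsPacking F H M ∧ M.card ≤ q ∧
    indexVector P (H.vertexSet \ covered M) ∈ L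

/-- `u` and `v` are `(F, b, i)`-reachable in `H`: there are at least `b * n ^ (i * m - 1)` sets `S`
of `i * m - 1` vertices such that both `H[S ∪ {u}]` and `H[S ∪ {v}]` have perfect `F`-packings. -/
def IsReachable {β α : Type*} (F : Hypergraph β) (H : Hypergraph α) (b : ℝ) (i : ℕ)
    (u v : α) : Prop :=
  b * (H.vertexSet.ncard : ℝ) ^ (i * F.vertexSet.ncard - 1) ≤
    ({S | S ⊆ H.vertexSet ∧ S.ncard = i * F.vertexSet.ncard - 1 ∧
      HasPerfectPacking F (H.induce (S ∪ {u})) ∧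
      HasPerfectPacking F (H.induce (S ∪ {v}))}.ncard : ℝ)

/-- Any two (distinct) vertices of `U` are `(F, b, i)`-reachable in `H`. -/
def IsClosedIn {β α : Type*} (F : Hypergraph β) (H : Hypergraph α) (b : ℝ) (i : ℕ)
    (U : Set α) : Prop :=
  ∀ u ∈ U, ∀ v ∈ U, u ≠ v → IsReachable F H b i u v

/-- `P` is an `(F, b, t, c)`-good partition of `V(H)`. -/
def IsGoodPartition {β α : Type*} (F : Hypergraph β) (H : Hypergraph α) (b : ℝ) (t : ℕ) (c : ℝ)
    {d : ℕ} (P : Fin d → Set α) : Prop :=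
  IsOrderedPartition P H.vertexSet ∧
    (∀ i, IsClosedIn F H b t (P i)) ∧
    ∀ i, c * (H.vertexSet.ncard : ℝ) ≤ ((P i).ncard : ℝ)

end Hypergraph

/-! Whether a packing is perfect depends only on the vertex sets of its copies. The heart of the
argument therefore concerns a family `C` of `m`-subsets of a finite set `X`, coloured by the parts
of the partition.

Necessity is algebraic. In an abelian group of order at most `q`, a finite sum equals a subsum with
at most `q` terms, because two initial sums of a longer one coincide and the block between them can
be deleted (`exists_subset_card_le_sum_eq`). Applied to the cosets of the index vectors in a perfect
packing, this gives at most `q` copies whose removal leaves an index vector in the lattice.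

Sufficiency is by absorption. Let `v` be the index vector, in the lattice, of a bounded set `u`.
Write `v` as a difference of two short sums of robust vectors, and realise these sums by disjoint
packable sets `A` and `B`. Then `A` and `u ∪ B` have the same colour counts, so some bijection pairs
each `y` in `A` with a vertex of `u ∪ B` in the same part. Reachability supplies a set `S y` that
can be packed with either vertex of the pair. The union of `A`, `B` and all the `S y` is packable,
and remains so after adding `u`. Double counting makes one choice of the `S y` serve a positive
proportion of all candidates `u` (`exists_absorber`). Since there are only polynomially many
candidates, iterating gives one set of size a small fraction of `n` that absorbs every candidate
disjoint from it (`exists_absorbing_set`).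

To finish, remove the solution packing and `q + 1` disjoint absorbing sets, and pack almost
everything else. The leftover need not lie in the lattice, but adding the vertices of at most `q`
suitable copies corrects this. Those copies spoil at most `q` of the absorbing sets, and an
unspoiled one absorbs the corrected leftover (`packable_of_absorbing_sets`). -/

open Finset

/-! ### Packable sets, double counting and short sums in finite groups -/

namespace SetPacking

variable {α ι κ : Type*} [DecidableEq α]

/-- `S` is the disjoint union of finitely many members of the family `C`. -/
def Packable (C : Set (Finset α)) (S : Finset α) : Prop :=
  ∃ M : Finset (Finset α), (∀ A ∈ M, A ∈ C) ∧ (M : Set (Finset α)).PairwiseDisjoint id ∧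
    M.biUnion id = S

lemma packable_empty (C : Set (Finset α)) : Packable C ∅ :=
  ⟨∅, by simp, by simp, by simp⟩

lemma packable_of_mem {C : Set (Finset α)} {A : Finset α} (hA : A ∈ C) : Packable C A :=
  ⟨{A}, by simpa using hA, by simp, by simp⟩

lemma pairwiseDisjoint_union {M N : Finset (Finset α)}
    (hM : (M : Set (Finset α)).PairwiseDisjoint id)
    (hN : (N : Set (Finset α)).PairwiseDisjoint id)
    (h : Disjoint (M.biUnion id) (N.biUnion id)) :
    ((M ∪ N : Finset (Finset α)) : Set (Finset α)).PairwiseDisjoint id := by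
  rw [Finset.coe_union, Set.pairwiseDisjoint_union]
  refine ⟨hM, hN, fun A hA B hB _ => ?_⟩
  exact h.mono (Finset.subset_biUnion_of_mem id hA) (Finset.subset_biUnion_of_mem id hB)

lemma Packable.union {C : Set (Finset α)} {S T : Finset α} (hS : Packable C S)
    (hT : Packable C T) (h : Disjoint S T) : Packable C (S ∪ T) := by
  obtain ⟨M, hM, hMd, rfl⟩ := hS
  obtain ⟨N, hN, hNd, rfl⟩ := hT
  refine ⟨M ∪ N, ?_, pairwiseDisjoint_union hMd hNd h, ?_⟩
  · intro A hA
    rcases Finset.mem_union.1 hA with hA | hA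
    exacts [hM A hA, hN A hA]
  · rw [Finset.union_biUnion]

lemma Packable.biUnion {C : Set (Finset α)} (s : Finset ι) (f : ι → Finset α)
    (hf : ∀ i ∈ s, Packable C (f i)) (hd : (s : Set ι).PairwiseDisjoint f) :
    Packable C (s.biUnion f) := by
  classical
  induction s using Finset.induction_on with
  | empty => simpa using packable_empty C
  | insert a s ha ih =>
    rw [Finset.biUnion_insert]
    refine (hf a (by simp)).union
      (ih (fun i hi => hf i (by simp [hi])) (hd.subset (by simp))) ?_
    rw [Finset.disjoint_biUnion_right]
    intro i hi
    exact hd (by simp) (by simp [hi]) (fun h => ha (h ▸ hi))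

/-- Few `s`-subsets of `X` meet a small set `Z`. -/
lemma card_powersetCard_meeting_mul_le (X Z : Finset α) (s : ℕ) :
    #{S ∈ powersetCard s X | ¬ Disjoint S Z} * #X ≤ #Z * #X ^ s := by
  -- Multiplying the natural bound `#Z * #X ^ (s - 1)` through by `#X` avoids a truncated exponent.
  -- For `s = 0` nothing is counted, since the empty set meets nothing.
  cases s with
  | zero => simp [filter_singleton]
  | succ s =>
    have h : {S ∈ powersetCard (s + 1) X | ¬ Disjoint S Z} ⊆
        Z.biUnion (fun z => (powersetCard s X).image (insert z)) := by
      intro S hS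
      simp only [mem_filter, mem_powersetCard, Finset.not_disjoint_iff] at hS
      obtain ⟨⟨hSX, hc⟩, z, hzS, hzZ⟩ := hS
      simp only [mem_biUnion, mem_image, mem_powersetCard]
      exact ⟨z, hzZ, S.erase z, ⟨(erase_subset _ _).trans hSX, by
        rw [card_erase_of_mem hzS, hc]; rfl⟩, insert_erase hzS⟩
    have h2 : #{S ∈ powersetCard (s + 1) X | ¬ Disjoint S Z} ≤ #Z * #X ^ s := by
      refine (card_le_card h).trans (card_biUnion_le_card_mul _ _ _ fun z _ => ?_)
      refine card_image_le.trans ?_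
      rw [card_powersetCard]
      exact Nat.choose_le_pow _ _
    calc _ ≤ #Z * #X ^ s * #X := Nat.mul_le_mul_right _ h2
      _ = _ := by ring

/-- If every `u` is related to many members of a family, some member is related to many `u`. -/
lemma exists_popular (U : Finset ι) (𝓢 : Finset κ) (r : ι → κ → Prop)
    [∀ u S, Decidable (r u S)] {θ N : ℝ} (hθ : 0 < θ) (hN : 0 < N) (hS : (#𝓢 : ℝ) ≤ N)
    (hU : U.Nonempty) (h : ∀ u ∈ U, θ * N ≤ (#{S ∈ 𝓢 | r u S} : ℝ)) :
    ∃ S ∈ 𝓢, θ * (#U : ℝ) ≤ (#{u ∈ U | r u S} : ℝ) := by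
  by_contra! hcon
  -- The contradiction compares two counts of the related pairs; the upper count is strict only if
  -- `𝓢` is nonempty.
  have hne : 𝓢.Nonempty := by
    obtain ⟨u, hu⟩ := hU
    have h1 := h u hu
    rw [nonempty_iff_ne_empty]
    rintro rfl
    simp only [filter_empty, card_empty, Nat.cast_zero] at h1
    nlinarith [mul_pos hθ hN]
  have hdc : (∑ u ∈ U, (#{S ∈ 𝓢 | r u S} : ℝ)) = ∑ S ∈ 𝓢, (#{u ∈ U | r u S} : ℝ) := by
    exact_mod_cast sum_card_bipartiteAbove_eq_sum_card_bipartiteBelow (s := U) (t := 𝓢) r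
  have h1 : (#U : ℝ) * (θ * N) ≤ ∑ u ∈ U, (#{S ∈ 𝓢 | r u S} : ℝ) := by
    simpa using card_nsmul_le_sum U _ _ h
  have h2 : ∑ S ∈ 𝓢, (#{u ∈ U | r u S} : ℝ) < (#𝓢 : ℝ) * (θ * (#U : ℝ)) := by
    simpa using sum_lt_sum_of_nonempty hne hcon
  have h3 : (#𝓢 : ℝ) * (θ * (#U : ℝ)) ≤ N * (θ * (#U : ℝ)) := by gcongr
  nlinarith

/-- Two finite sets with equally many elements of every colour are in colour-preserving
bijection. -/
lemma exists_colour_bijOn {β κ : Type*} [DecidableEq κ] (col : β → κ) (A B : Finset β)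
    (h : ∀ i, #{x ∈ A | col x = i} = #{x ∈ B | col x = i}) :
    ∃ e : β → β, Set.BijOn e A B ∧ ∀ x ∈ A, col (e x) = col x := by
  have h1 : ∀ i, ∃ f : β → β, Set.BijOn f ({x ∈ A | col x = i} : Finset β)
      ({x ∈ B | col x = i} : Finset β) := by
    intro i
    rcases isEmpty_or_nonempty β with hβ | hβ
    · exact ⟨id, by
        rw [Finset.eq_empty_of_isEmpty {x ∈ A | col x = i},
          Finset.eq_empty_of_isEmpty {x ∈ B | col x = i}]; simp⟩
    · exact (Finset.finite_toSet _).exists_bijOn_of_encard_eq (by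
        rw [Set.encard_coe_eq_coe_finsetCard, Set.encard_coe_eq_coe_finsetCard, h i])
  choose f hf using h1
  have key : ∀ x ∈ A, f (col x) x ∈ B ∧ col (f (col x) x) = col x := by
    intro x hx
    have := (hf (col x)).mapsTo (x := x) (by simp [hx])
    simpa using this
  refine ⟨fun x => f (col x) x, ⟨fun x hx => (key x hx).1, ?_, ?_⟩, fun x hx => (key x hx).2⟩
  · intro x hx y hy hxy
    have hxy' : f (col x) x = f (col y) y := hxy
    have hc : col x = col y := by rw [← (key x hx).2, ← (key y hy).2, hxy']
    refine (hf (col x)).injOn (by simpa using hx) (by simpa [hc] using hy) ?_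
    rw [hxy', hc]
  · intro b hb
    obtain ⟨a, ha, hab⟩ := (hf (col b)).surjOn (show b ∈ _ by simpa using hb)
    simp only [coe_filter, Set.mem_ofPred_eq] at ha
    exact ⟨a, ha.1, by simp only [ha.2, hab]⟩

/-- In a finite abelian group of order at most `q`, every finite sum can be shortened to a
subsum with at most `q` terms. -/
lemma exists_subset_card_le_sum_eq {Q : Type*} [AddCommGroup Q] [Finite Q] {q : ℕ}
    (hq : Nat.card Q ≤ q) (M : Finset ι) (g : ι → Q) :
    ∃ N ⊆ M, #N ≤ q ∧ ∑ i ∈ N, g i = ∑ i ∈ M, g i := by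
  classical
  induction M using Finset.strongInduction with
  | H M ih =>
    by_cases hM : #M ≤ q
    · exact ⟨M, Subset.rfl, hM, rfl⟩
    -- Pigeonhole on the sums over proper initial segments of an enumeration of `M`: there are `#M >
    -- q` of them.
    have hinj : ¬ Function.Injective (fun j : Fin (#M) =>
        ∑ i ∈ M with ∃ h : i ∈ M, M.equivFin ⟨i, h⟩ < j, g i) := by
      intro hi
      have := Nat.card_le_card_of_injective _ hi
      rw [Nat.card_fin] at this
      omega
    obtain ⟨j, l, hjl, hlt⟩ : ∃ j l : Fin (#M),
        (∑ i ∈ M with ∃ h : i ∈ M, M.equivFin ⟨i, h⟩ < j, g i =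
        ∑ i ∈ M with ∃ h : i ∈ M, M.equivFin ⟨i, h⟩ < l, g i) ∧ j < l := by
      simp only [Function.Injective, not_forall] at hinj
      obtain ⟨a, b, h, hne⟩ := hinj
      rcases lt_or_gt_of_ne hne with h' | h'
      exacts [⟨a, b, h, h'⟩, ⟨b, a, h.symm, h'⟩]
    set A := M.filter (fun i => ∃ h : i ∈ M, M.equivFin ⟨i, h⟩ < j)
    set B := M.filter (fun i => ∃ h : i ∈ M, M.equivFin ⟨i, h⟩ < l)
    have hAB : A ⊆ B := by
      intro i hi
      simp only [A, B, mem_filter] at hi ⊢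
      obtain ⟨h1, h2, h3⟩ := hi
      exact ⟨h1, h2, h3.trans hlt⟩
    have hBM : B ⊆ M := filter_subset _ _
    have h0 : ∑ i ∈ B \ A, g i = 0 := by
      have := sum_sdiff (f := g) hAB
      rw [hjl] at this
      simpa using this
    have hmem : ((M.equivFin.symm j : M) : ι) ∈ B \ A := by
      simp [A, B, hlt]
    have hss : M \ (B \ A) ⊂ M := by
      refine ⟨sdiff_subset, fun h => ?_⟩
      have := h (hBM (mem_sdiff.1 hmem).1)
      simp only [mem_sdiff] at this hmem
      exact this.2 hmem
    obtain ⟨N, hN, hc, hs⟩ := ih _ hss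
    refine ⟨N, hN.trans sdiff_subset, hc, hs.trans ?_⟩
    have := sum_sdiff (f := g) (sdiff_subset.trans hBM : B \ A ⊆ M)
    rw [h0, add_zero] at this
    exact this

end SetPacking

/-! ### Index vectors and a single absorbing step -/

namespace SetPacking

section Core

open scoped Classical

variable {α ι : Type*} {d : ℕ}

/-- The index vector of a finite set with respect to a colouring. -/
noncomputable def idx (col : α → Fin d) (S : Finset α) : Fin d → ℤ :=
  fun i => (#{x ∈ S | col x = i} : ℤ)

lemma idx_union (col : α → Fin d) {S T : Finset α} (h : Disjoint S T) :
    idx col (S ∪ T) = idx col S + idx col T := by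
  funext i
  simp only [idx, Pi.add_apply, filter_union]
  rw [card_union_of_disjoint (disjoint_filter_filter h)]
  push_cast
  rfl

@[simp] lemma idx_empty (col : α → Fin d) : idx col ∅ = 0 := by
  funext i
  simp [idx]

lemma idx_biUnion (col : α → Fin d) {M : Finset (Finset α)}
    (hM : (M : Set (Finset α)).PairwiseDisjoint id) :
    idx col (M.biUnion id) = ∑ A ∈ M, idx col A := by
  induction M using Finset.induction_on with
  | empty => simp
  | insert A M hA ih =>
    have hd : Disjoint A (M.biUnion id) := by
      rw [disjoint_biUnion_right]
      intro B hB
      exact hM (by simp) (by simp [hB]) (fun h => hA (h ▸ hB))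
    rw [biUnion_insert, id, idx_union col hd, ih (hM.subset (by simp)), sum_insert hA]

lemma sum_idx (col : α → Fin d) (S : Finset α) : ∑ i, idx col S i = #S := by
  simp only [idx]
  rw [card_eq_sum_card_fiberwise (f := col) (t := univ) (by simp)]
  push_cast
  rfl

/-- Disjoint small sets `S y` that can swap `y` for `e u y`, simultaneously for a positive
proportion of the `u`. -/
lemma exists_swappers {X : Finset α} {C : Set (Finset α)} {col : α → Fin d} {s : ℕ} {θ : ℝ}
    (hθ : 0 < θ) (hX : X.Nonempty)
    (hreach : ∀ x ∈ X, ∀ y ∈ X, x ≠ y → col x = col y → 2 * θ * (#X : ℝ) ^ s ≤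
      (#{S ∈ powersetCard s X | Packable C (insert x S) ∧ Packable C (insert y S)} : ℝ))
    {U : Finset ι} (hU : U.Nonempty) (e : ι → α → α) (Z A : Finset α) (hAX : A ⊆ X)
    (he : ∀ u ∈ U, ∀ y ∈ A, e u y ∈ X ∧ e u y ≠ y ∧ col (e u y) = col y)
    (hZ : (#Z : ℝ) + #A * s ≤ θ * #X) :
    ∃ S : α → Finset α, (∀ y ∈ A, S y ⊆ X ∧ #(S y) = s ∧ Disjoint (S y) Z ∧
        Packable C (insert y (S y))) ∧
      (A : Set α).PairwiseDisjoint S ∧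
      ∃ U' ⊆ U, θ ^ #A * (#U : ℝ) ≤ (#U' : ℝ) ∧
        ∀ u ∈ U', ∀ y ∈ A, Packable C (insert (e u y) (S y)) := by
  induction A using Finset.induction_on with
  | empty => exact ⟨fun _ => ∅, by simp, by simp, U, Subset.rfl, by simp, by simp⟩
  | insert y A hy ih =>
    rw [card_insert_of_notMem hy] at hZ
    push_cast at hZ
    obtain ⟨S, hS, hSd, U', hU'U, hU'c, hU'⟩ := ih ((subset_insert _ _).trans hAX)
      (fun u hu z hz => he u hu z (mem_insert_of_mem hz)) (by nlinarith [Nat.cast_nonneg (α := ℝ) s])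
    have hXpos : (0 : ℝ) < #X := by exact_mod_cast hX.card_pos
    have hU'ne : U'.Nonempty := by
      rw [← card_pos]
      have h1 : (0 : ℝ) < #U := by exact_mod_cast hU.card_pos
      have h2 : (0 : ℝ) < #U' := lt_of_lt_of_le (by positivity) hU'c
      exact_mod_cast h2
    -- The new set must also avoid the swappers already chosen. At most `θ * #X ^ s` of the
    -- candidates meet `Z'`, so half of the `2 * θ` in `hreach` survives.
    set Z' := Z ∪ A.biUnion S with hZ'
    have hZ'c : (#Z' : ℝ) ≤ θ * #X := by
      have h1 : #Z' ≤ #Z + #A * s :=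
        (card_union_le _ _).trans (Nat.add_le_add_left
          (card_biUnion_le_card_mul _ _ _ fun z hz => (hS z hz).2.1.le) _)
      have h2 : (#Z' : ℝ) ≤ #Z + #A * s := by exact_mod_cast h1
      nlinarith [Nat.cast_nonneg (α := ℝ) s]
    -- One set `T` that swaps `y` for `e u y` for a proportion `θ` of the surviving `u`; each
    -- element of `A` costs one factor `θ`.
    obtain ⟨T, hT, hTc⟩ := exists_popular U'
      {S ∈ powersetCard s X | Disjoint S Z' ∧ Packable C (insert y S)}
      (fun u S => Packable C (insert (e u y) S)) hθ (N := (#X : ℝ) ^ s) (by positivity)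
      (by
        have h1 := (card_filter_le (powersetCard s X)
          (fun S => Disjoint S Z' ∧ Packable C (insert y S))).trans
          ((card_powersetCard s X).le.trans (Nat.choose_le_pow _ _))
        exact_mod_cast h1) hU'ne
      (by
        intro u hu
        obtain ⟨h1, h2, h3⟩ := he u (hU'U hu) y (mem_insert_self _ _)
        have h4 := hreach _ h1 y (hAX (mem_insert_self _ _)) h2 h3
        have h5 : (#{S ∈ powersetCard s X | ¬ Disjoint S Z'} : ℝ) ≤ θ * (#X : ℝ) ^ s := by
          have h6 : (#{S ∈ powersetCard s X | ¬ Disjoint S Z'} : ℝ) * #X ≤ #Z' * (#X : ℝ) ^ s := by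
            exact_mod_cast card_powersetCard_meeting_mul_le X Z' s
          have h7 : (#Z' : ℝ) * (#X : ℝ) ^ s ≤ θ * #X * (#X : ℝ) ^ s := by gcongr
          refine le_of_mul_le_mul_right ?_ hXpos
          linarith
        have h8 : {S ∈ powersetCard s X |
            Packable C (insert (e u y) S) ∧ Packable C (insert y S)} ⊆
            {S ∈ {S ∈ powersetCard s X | Disjoint S Z' ∧ Packable C (insert y S)} |
              Packable C (insert (e u y) S)} ∪ {S ∈ powersetCard s X | ¬ Disjoint S Z'} := by
          intro S hS
          simp only [mem_union, mem_filter] at hS ⊢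
          tauto
        have h9 := (card_le_card h8).trans (card_union_le _ _)
        have h10 : (#{S ∈ powersetCard s X |
            Packable C (insert (e u y) S) ∧ Packable C (insert y S)} : ℝ) ≤
            #{S ∈ {S ∈ powersetCard s X | Disjoint S Z' ∧ Packable C (insert y S)} |
              Packable C (insert (e u y) S)} + #{S ∈ powersetCard s X | ¬ Disjoint S Z'} := by
          exact_mod_cast h9
        linarith)
    simp only [mem_filter, mem_powersetCard] at hT
    obtain ⟨⟨hTX, hTs⟩, hTZ, hTy⟩ := hT
    have hTZ1 : Disjoint T Z := hTZ.mono_right subset_union_left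
    have hTS : ∀ z ∈ A, Disjoint T (S z) := fun z hz =>
      hTZ.mono_right ((subset_biUnion_of_mem S hz).trans subset_union_right)
    have hne : ∀ z ∈ A, z ≠ y := fun z hz h => hy (h ▸ hz)
    refine ⟨Function.update S y T, ?_, ?_, {u ∈ U' | Packable C (insert (e u y) T)},
      (filter_subset _ _).trans hU'U, ?_, ?_⟩
    · intro z hz
      rcases mem_insert.1 hz with rfl | hz
      · simp only [Function.update_self]
        exact ⟨hTX, hTs, hTZ1, hTy⟩
      · rw [Function.update_of_ne (hne z hz)]
        exact hS z hz
    · rw [coe_insert, Set.pairwiseDisjoint_insert]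
      refine ⟨?_, ?_⟩
      · intro z hz w hw hzw
        simp only [Function.onFun]
        rw [Function.update_of_ne (hne z hz), Function.update_of_ne (hne w hw)]
        exact hSd hz hw hzw
      · intro z hz _
        rw [Function.update_self, Function.update_of_ne (hne z hz)]
        exact hTS z hz
    · rw [card_insert_of_notMem hy, pow_succ]
      calc θ ^ #A * θ * (#U : ℝ) = θ * (θ ^ #A * #U) := by ring
        _ ≤ θ * #U' := by gcongr
        _ ≤ _ := hTc
    · intro u hu z hz
      simp only [mem_filter] at hu
      rcases mem_insert.1 hz with rfl | hz
      · simpa using hu.2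
      · rw [Function.update_of_ne (hne z hz)]
        exact hU' u hu.1 z hz

/-- Disjoint members of the family with prescribed index vectors, avoiding a small set. -/
lemma exists_packable_idx_eq_sum {X : Finset α} {C : Set (Finset α)} {col : α → Fin d} {m : ℕ}
    {θ : ℝ} {I : Set (Fin d → ℤ)} (hC : ∀ A ∈ C, A ⊆ X ∧ #A = m)
    (hI : ∀ v ∈ I, ∀ Z : Finset α, (#Z : ℝ) ≤ θ * #X → ∃ A ∈ C, Disjoint A Z ∧ idx col A = v)
    (l : List (Fin d → ℤ)) (hl : ∀ v ∈ l, v ∈ I) (Z : Finset α)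
    (hZ : (#Z : ℝ) + m * l.length ≤ θ * #X) :
    ∃ A ⊆ X, Disjoint A Z ∧ Packable C A ∧ idx col A = l.sum ∧ #A = m * l.length := by
  induction l generalizing Z with
  | nil => exact ⟨∅, by simp, by simp, packable_empty C, by simp, by simp⟩
  | cons v l ih =>
    simp only [List.length_cons] at hZ
    push_cast at hZ
    have hm0 : (0 : ℝ) ≤ m * l.length := by positivity
    have hm1 : (0 : ℝ) ≤ m := by positivity
    obtain ⟨A, hAC, hAZ, hAv⟩ := hI v (hl v (by simp)) Z (by linarith)
    obtain ⟨hAX, hAm⟩ := hC A hAC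
    obtain ⟨B, hBX, hBZ, hB, hBi, hBc⟩ := ih (fun v hv => hl v (by simp [hv])) (Z ∪ A) (by
      have : (#(Z ∪ A) : ℝ) ≤ #Z + #A := by exact_mod_cast card_union_le _ _
      rw [hAm] at this
      linarith)
    rw [disjoint_union_right] at hBZ
    refine ⟨A ∪ B, union_subset hAX hBX, disjoint_union_left.2 ⟨hAZ, hBZ.1⟩,
      (packable_of_mem hAC).union hB hBZ.2.symm, ?_, ?_⟩
    · rw [idx_union col hBZ.2.symm, hAv, hBi, List.sum_cons]
    · rw [card_union_of_disjoint hBZ.2.symm, hAm, hBc, List.length_cons]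
      ring

/-- One absorbing step: a small packable set that meets or absorbs a positive proportion of the
sets in `U`. -/
lemma exists_absorber {X : Finset α} {C : Set (Finset α)} {col : α → Fin d} {m s D c : ℕ}
    {θ : ℝ} {I : Set (Fin d → ℤ)} (hθ : 0 < θ) (hθ1 : θ ≤ 1) (hX : X.Nonempty)
    (hC : ∀ A ∈ C, A ⊆ X ∧ #A = m)
    (hcol : ∀ x ∈ X, ∃ y ∈ X, y ≠ x ∧ col y = col x)
    (hreach : ∀ x ∈ X, ∀ y ∈ X, x ≠ y → col x = col y → 2 * θ * (#X : ℝ) ^ s ≤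
      (#{S ∈ powersetCard s X | Packable C (insert x S) ∧ Packable C (insert y S)} : ℝ))
    (hI : ∀ v ∈ I, ∀ Z : Finset α, (#Z : ℝ) ≤ θ * #X → ∃ A ∈ C, Disjoint A Z ∧ idx col A = v)
    (hrep : ∀ u ∈ AddSubgroup.closure I, (∀ i, 0 ≤ u i ∧ u i ≤ D) →
      ∃ l₁ l₂ : List (Fin d → ℤ), (∀ v ∈ l₁, v ∈ I) ∧ (∀ v ∈ l₂, v ∈ I) ∧ l₁.length ≤ c ∧
        l₂.length ≤ c ∧ u + l₂.sum = l₁.sum)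
    {U : Finset (Finset α)} (hU : U.Nonempty)
    (hUX : ∀ u ∈ U, u ⊆ X ∧ #u ≤ D ∧ idx col u ∈ AddSubgroup.closure I) (Z : Finset α)
    (hZ : (#Z : ℝ) + (2 * (m * c) + m * c * s : ℕ) ≤ θ * #X) :
    ∃ W ⊆ X, Disjoint W Z ∧ #W ≤ 2 * (m * c) + m * c * s ∧ Packable C W ∧
      θ ^ (m * c) / ((D : ℝ) + 1) ^ d * #U ≤
        (#{u ∈ U | ¬ Disjoint u W ∨ Packable C (u ∪ W)} : ℝ) := by
  -- restrict to a popular index vector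
  obtain ⟨v, hv, hvc⟩ := exists_le_card_fiber_of_nsmul_le_card_of_maps_to
    (s := U) (t := Fintype.piFinset (fun _ : Fin d => range (D + 1)))
    (f := fun u i => #{x ∈ u | col x = i}) (b := (#U : ℝ) / ((D : ℝ) + 1) ^ d)
    (by
      intro u hu
      simp only [Fintype.mem_piFinset, mem_range]
      exact fun i => Nat.lt_succ_of_le ((card_filter_le _ _).trans (hUX u hu).2.1))
    ⟨0, by simp⟩
    (by
      simp only [Fintype.card_piFinset, card_range, prod_const, card_univ, Fintype.card_fin,
        nsmul_eq_mul]
      push_cast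
      rw [mul_div_cancel₀]
      positivity)
  set U₁ := {u ∈ U | (fun i => #{x ∈ u | col x = i}) = v} with hU₁
  have hUpos : (0 : ℝ) < #U := by exact_mod_cast hU.card_pos
  have hU₁ne : U₁.Nonempty := by
    rw [← card_pos]
    have : (0 : ℝ) < #U₁ := lt_of_lt_of_le (by positivity) hvc
    exact_mod_cast this
  have hU₁idx : ∀ u ∈ U₁, idx col u = fun i => (v i : ℤ) := by
    intro u hu
    simp only [hU₁, mem_filter] at hu
    funext i
    simp only [idx, ← hu.2]
  obtain ⟨u₀, hu₀⟩ := hU₁ne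
  -- The lists are realised below by `A` and `B`. The identity `v + l₂.sum = l₁.sum` then says that
  -- `A` and `u ∪ B` have equal colour counts for every `u` in `U₁` disjoint from `B`.
  obtain ⟨l₁, l₂, hl₁, hl₂, hc₁, hc₂, hsum⟩ := hrep (fun i => (v i : ℤ))
    (by rw [← hU₁idx u₀ hu₀]; exact (hUX u₀ (filter_subset _ _ hu₀)).2.2)
    (by
      intro i
      simp only [Fintype.mem_piFinset, mem_range] at hv
      have := hv i
      exact ⟨by positivity, by exact_mod_cast Nat.le_of_lt_succ this⟩)
  have hm₁ : m * l₁.length ≤ m * c := Nat.mul_le_mul_left _ hc₁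
  have hm₂ : m * l₂.length ≤ m * c := Nat.mul_le_mul_left _ hc₂
  have hm₁' : (m : ℝ) * l₁.length ≤ m * c := by exact_mod_cast hm₁
  have hm₂' : (m : ℝ) * l₂.length ≤ m * c := by exact_mod_cast hm₂
  have hms' : (m : ℝ) * l₁.length * s ≤ m * c * s := by gcongr
  have hmc0 : (0 : ℝ) ≤ m * c := by positivity
  have hmcs0 : (0 : ℝ) ≤ m * c * s := by positivity
  push_cast at hZ
  obtain ⟨A, hAX, hAZ, hA, hAi, hAc⟩ := exists_packable_idx_eq_sum hC hI l₁ hl₁ Z (by linarith)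
  have hAc' : (#A : ℝ) = m * l₁.length := by exact_mod_cast hAc
  obtain ⟨B, hBX, hBZ, hB, hBi, hBc⟩ := exists_packable_idx_eq_sum hC hI l₂ hl₂ (Z ∪ A) (by
    have : (#(Z ∪ A) : ℝ) ≤ #Z + #A := by exact_mod_cast card_union_le _ _
    linarith)
  have hBc' : (#B : ℝ) = m * l₂.length := by exact_mod_cast hBc
  rw [disjoint_union_right] at hBZ
  obtain ⟨hBZ, hBA⟩ := hBZ
  -- the colour-preserving bijections
  have hbij : ∀ u ∈ U₁, ∃ e : α → α, (∀ y ∈ A, e y ∈ X ∧ e y ≠ y ∧ col (e y) = col y) ∧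
      (Disjoint u (A ∪ B) → Set.BijOn e A (u ∪ B : Finset α)) := by
    intro u hu
    by_cases hd : Disjoint u (A ∪ B)
    · rw [disjoint_union_right] at hd
      have hi : idx col A = idx col (u ∪ B) := by
        rw [idx_union col hd.2, hU₁idx u hu, hBi, hAi, hsum]
      obtain ⟨e, he, hec⟩ := exists_colour_bijOn col A (u ∪ B) (by
        intro i
        have := congrFun hi i
        simp only [idx] at this
        exact_mod_cast this)
      refine ⟨e, fun y hy => ?_, fun _ => he⟩
      have hey := he.mapsTo hy
      rw [mem_coe, mem_union] at hey
      refine ⟨?_, ?_, hec y hy⟩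
      · rcases hey with h | h
        exacts [(hUX u (filter_subset _ _ hu)).1 h, hBX h]
      · intro h
        rw [h] at hey
        rcases hey with h | h
        exacts [disjoint_left.1 hd.1 h hy, disjoint_left.1 hBA h hy]
    · choose! e he using hcol
      exact ⟨e, fun y hy => he y (hAX hy), fun h => absurd h hd⟩
  have : Nonempty α := ⟨hX.choose⟩
  choose! e he heb using hbij
  obtain ⟨S, hS, hSd, U₂, hU₂, hU₂c, hU₂p⟩ := exists_swappers hθ hX hreach ⟨u₀, hu₀⟩ e
    (Z ∪ (A ∪ B)) A hAX he (by
      have h1 : (#(Z ∪ (A ∪ B)) : ℝ) ≤ #Z + (#A + #B) := by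
        exact_mod_cast (card_union_le _ _).trans (Nat.add_le_add_left (card_union_le _ _) _)
      rw [hAc'] at h1 ⊢
      linarith)
  have hSA : ∀ y ∈ A, Disjoint (S y) A := fun y hy =>
    (hS y hy).2.2.1.mono_right (subset_union_left.trans subset_union_right)
  have hSB : ∀ y ∈ A, Disjoint (S y) B := fun y hy =>
    (hS y hy).2.2.1.mono_right (subset_union_right.trans subset_union_right)
  have hSZ : ∀ y ∈ A, Disjoint (S y) Z := fun y hy =>
    (hS y hy).2.2.1.mono_right subset_union_left
  have hins : ∀ e : α → α, A.biUnion (fun y => insert (e y) (S y)) = A.image e ∪ A.biUnion S := by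
    intro e
    ext x
    simp only [mem_biUnion, mem_insert, mem_union, mem_image]
    constructor
    · rintro ⟨y, hy, rfl | h⟩
      exacts [Or.inl ⟨y, hy, rfl⟩, Or.inr ⟨y, hy, h⟩]
    · rintro (⟨y, hy, rfl⟩ | ⟨y, hy, h⟩)
      exacts [⟨y, hy, Or.inl rfl⟩, ⟨y, hy, Or.inr h⟩]
  have hpack : ∀ e : α → α, Set.InjOn e A → Disjoint (A.image e) (A.biUnion S) →
      (∀ y ∈ A, Packable C (insert (e y) (S y))) → Packable C (A.image e ∪ A.biUnion S) := by
    intro e hei hed hep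
    rw [← hins]
    refine Packable.biUnion _ _ hep fun y hy z hz hyz => ?_
    have h1 : ∀ y ∈ A, ∀ z ∈ A, e y ∉ S z := fun y hy z hz h =>
      disjoint_left.1 hed (mem_image_of_mem e hy) (mem_biUnion.2 ⟨z, hz, h⟩)
    simp only [Function.onFun]
    rw [disjoint_insert_left, disjoint_insert_right, mem_insert, not_or]
    exact ⟨⟨fun h => hyz (hei hy hz h), h1 y hy z hz⟩, h1 z hz y hy, hSd hy hz hyz⟩
  have hAS : Disjoint A (A.biUnion S) :=
    (disjoint_biUnion_right _ _ _).2 fun y hy => (hSA y hy).symm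
  have hBS : Disjoint B (A.biUnion S) :=
    (disjoint_biUnion_right _ _ _).2 fun y hy => (hSB y hy).symm
  refine ⟨A ∪ A.biUnion S ∪ B, ?_, ?_, ?_, ?_, ?_⟩
  · exact union_subset (union_subset hAX (biUnion_subset.2 fun y hy => (hS y hy).1)) hBX
  · rw [disjoint_union_left, disjoint_union_left, disjoint_biUnion_left]
    exact ⟨⟨hAZ, hSZ⟩, hBZ⟩
  · have h1 : #(A.biUnion S) ≤ #A * s :=
      card_biUnion_le_card_mul _ _ _ fun y hy => (hS y hy).2.1.le
    have h2 : #(A ∪ A.biUnion S ∪ B) ≤ #A + #(A.biUnion S) + #B :=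
      (card_union_le _ _).trans (Nat.add_le_add_right (card_union_le _ _) _)
    have h3 : #A * s ≤ m * c * s := Nat.mul_le_mul_right _ (hAc ▸ hm₁)
    omega
  -- Without `u`, each `y` is packed with its own `S y`, and `B` is packed by itself.
  · refine Packable.union ?_ hB (disjoint_union_left.2 ⟨hBA.symm, hBS.symm⟩)
    have := hpack id (Set.injOn_id _) (by simpa using hAS) (fun y hy => (hS y hy).2.2.2)
    simpa using this
  · have hsub : U₂ ⊆ {u ∈ U | ¬ Disjoint u (A ∪ A.biUnion S ∪ B) ∨
        Packable C (u ∪ (A ∪ A.biUnion S ∪ B))} := by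
      intro u hu
      have hu₁ := hU₂ hu
      refine mem_filter.2 ⟨filter_subset _ _ hu₁, ?_⟩
      by_cases hd : Disjoint u (A ∪ A.biUnion S ∪ B)
      · right
        simp only [disjoint_union_right] at hd
        obtain ⟨⟨huA, huS⟩, huB⟩ := hd
        -- With `u`, the sets `S y` take the vertices of `u ∪ B` instead, which frees `A` to be
        -- packed by itself.
        have hb := heb u hu₁ (disjoint_union_right.2 ⟨huA, huB⟩)
        have him : A.image (e u) = u ∪ B := by
          rw [← coe_inj, coe_image]
          exact hb.image_eq
        have hp := hpack (e u) hb.injOn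
          (by rw [him]; exact disjoint_union_left.2 ⟨huS, hBS⟩) (hU₂p u hu)
        rw [him] at hp
        have := hA.union hp (by
          simp only [disjoint_union_right]
          exact ⟨⟨huA.symm, hBA.symm⟩, hAS⟩)
        convert this using 1
        ext x
        simp only [mem_union]
        tauto
      · exact Or.inl hd
    have h1 : (#U₂ : ℝ) ≤ _ := Nat.cast_le.2 (card_le_card hsub)
    refine le_trans ?_ h1
    refine le_trans ?_ hU₂c
    rw [div_mul_eq_mul_div, mul_div_assoc]
    have h2 : θ ^ (m * c) ≤ θ ^ #A := pow_le_pow_of_le_one hθ.le hθ1 (hAc ▸ hm₁)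
    exact mul_le_mul h2 hvc (by positivity) (by positivity)

end Core

end SetPacking

/-! ### Absorbing sets and completion of the packing -/

namespace SetPacking

section Core

open scoped Classical

variable {α ι : Type*} {d : ℕ}

/-- Iterating a step that deals with a proportion `η` of a family of sets yields a single packable
set absorbing all of the family. -/
lemma exists_absorbing_set {X : Finset α} {C : Set (Finset α)} {w : ℕ} {η B : ℝ}
    (hη1 : η ≤ 1)
    {good : Finset α → Prop}
    (hstep : ∀ U : Finset (Finset α), U.Nonempty → (∀ u ∈ U, good u) → ∀ Z : Finset α,
      (#Z : ℝ) + w ≤ B → ∃ W ⊆ X, Disjoint W Z ∧ #W ≤ w ∧ Packable C W ∧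
        η * #U ≤ (#{u ∈ U | ¬ Disjoint u W ∨ Packable C (u ∪ W)} : ℝ))
    (K : ℕ) (U : Finset (Finset α)) (hU : ∀ u ∈ U, good u) (hK : #U * (1 - η) ^ K < 1)
    (Z : Finset α) (hZ : (#Z : ℝ) + K * w ≤ B) :
    ∃ R ⊆ X, Disjoint R Z ∧ #R ≤ K * w ∧ Packable C R ∧
      ∀ u ∈ U, Disjoint u R → Packable C (u ∪ R) := by
  induction K generalizing U Z with
  | zero =>
    have : U = ∅ := by
      rw [← card_eq_zero]
      have h : (#U : ℝ) < 1 := by simpa using hK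
      have h' : #U < 1 := by exact_mod_cast h
      omega
    exact ⟨∅, by simp, by simp, by simp, packable_empty C, by simp [this]⟩
  | succ K ih =>
    rcases U.eq_empty_or_nonempty with rfl | hne
    · exact ⟨∅, by simp, by simp, by simp, packable_empty C, by simp⟩
    push_cast at hZ
    have hw0 : (0 : ℝ) ≤ K * w := by positivity
    obtain ⟨W, hWX, hWZ, hWw, hW, hWc⟩ := hstep U hne hU Z (by linarith)
    -- Sets that meet `W` can be dropped, since the conclusion only concerns sets disjoint from the
    -- final `R ∪ W`. Absorbed sets stay absorbed when a disjoint packable set is added.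
    set U' := {u ∈ U | ¬ (¬ Disjoint u W ∨ Packable C (u ∪ W))} with hU'
    have hc : (#U' : ℝ) ≤ (1 - η) * #U := by
      have h1 : (#{u ∈ U | ¬ Disjoint u W ∨ Packable C (u ∪ W)} : ℝ) + #U' = #U := by
        exact_mod_cast card_filter_add_card_filter_not (s := U)
          (fun u => ¬ Disjoint u W ∨ Packable C (u ∪ W))
      linarith
    obtain ⟨R, hRX, hRZ, hRc, hR, hRU⟩ := ih U' (fun u hu => hU u (filter_subset _ _ hu))
      (by
        refine lt_of_le_of_lt ?_ hK
        rw [pow_succ']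
        have h0 : 0 ≤ (1 - η) ^ K := pow_nonneg (by linarith) _
        calc (#U' : ℝ) * (1 - η) ^ K ≤ (1 - η) * #U * (1 - η) ^ K := by gcongr
          _ = _ := by ring)
      (Z ∪ W) (by
        have h1 : (#(Z ∪ W) : ℝ) ≤ #Z + #W := by exact_mod_cast card_union_le _ _
        have h2 : (#W : ℝ) ≤ w := by exact_mod_cast hWw
        linarith)
    rw [disjoint_union_right] at hRZ
    refine ⟨R ∪ W, union_subset hRX hWX, disjoint_union_left.2 ⟨hRZ.1, hWZ⟩, ?_,
      hR.union hW hRZ.2, ?_⟩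
    · calc #(R ∪ W) ≤ #R + #W := card_union_le _ _
        _ ≤ (K + 1) * w := by rw [add_mul, one_mul]; omega
    · intro u hu hd
      rw [disjoint_union_right] at hd
      by_cases h : Packable C (u ∪ W)
      · have := h.union hR (disjoint_union_left.2 ⟨hd.1, hRZ.2.symm⟩)
        rwa [union_assoc, union_comm W R] at this
      · have huU' : u ∈ U' := mem_filter.2 ⟨hu, by simp [h, hd.2]⟩
        have := (hRU u huU' hd.1).union hW (disjoint_union_left.2 ⟨hd.2, hRZ.2⟩)
        rwa [union_assoc] at this

/-- Several disjoint absorbing sets. -/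
lemma exists_disjoint_absorbing_sets {X : Finset α} {C : Set (Finset α)} {r : ℕ} {B : ℝ}
    {U : Finset (Finset α)}
    (hstep : ∀ Z : Finset α, (#Z : ℝ) + r ≤ B → ∃ R ⊆ X, Disjoint R Z ∧ #R ≤ r ∧ Packable C R ∧
      ∀ u ∈ U, Disjoint u R → Packable C (u ∪ R))
    (q : ℕ) (Z : Finset α) (hZ : (#Z : ℝ) + q * r ≤ B) :
    ∃ R : ℕ → Finset α, (∀ j ∈ range q, R j ⊆ X ∧ Disjoint (R j) Z ∧ #(R j) ≤ r ∧
        Packable C (R j) ∧ ∀ u ∈ U, Disjoint u (R j) → Packable C (u ∪ R j)) ∧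
      (range q : Set ℕ).PairwiseDisjoint R := by
  induction q with
  | zero => exact ⟨fun _ => ∅, by simp, by simp⟩
  | succ q ih =>
    push_cast at hZ
    obtain ⟨R, hR, hRd⟩ := ih (by linarith [Nat.cast_nonneg (α := ℝ) r])
    obtain ⟨T, hTX, hTZ, hTc, hT, hTU⟩ := hstep (Z ∪ (range q).biUnion R) (by
      have h1 : #(Z ∪ (range q).biUnion R) ≤ #Z + q * r := by
        refine (card_union_le _ _).trans (Nat.add_le_add_left ?_ _)
        simpa using card_biUnion_le_card_mul (range q) R r fun j hj => (hR j hj).2.2.1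
      have h2 : (#(Z ∪ (range q).biUnion R) : ℝ) ≤ #Z + q * r := by exact_mod_cast h1
      linarith)
    rw [disjoint_union_right, disjoint_biUnion_right] at hTZ
    have hne : ∀ j ∈ range q, j ≠ q := fun j hj => (mem_range.1 hj).ne
    refine ⟨Function.update R q T, ?_, ?_⟩
    · intro j hj
      rw [range_add_one] at hj
      rcases mem_insert.1 hj with rfl | hj
      · simp only [Function.update_self]
        exact ⟨hTX, hTZ.1, hTc, hT, hTU⟩
      · rw [Function.update_of_ne (hne j hj)]
        exact hR j hj
    · rw [range_add_one, coe_insert, Set.pairwiseDisjoint_insert]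
      refine ⟨?_, ?_⟩
      · intro z hz w hw hzw
        simp only [Function.onFun]
        rw [Function.update_of_ne (hne z hz), Function.update_of_ne (hne w hw)]
        exact hRd hz hw hzw
      · intro z hz _
        rw [Function.update_self, Function.update_of_ne (hne z hz)]
        exact hTZ.2 z hz

lemma sdiff_eq_sdiff_sdiff_union {X Z R M : Finset α} (hR : R ⊆ X) (hM : M ⊆ X \ (Z ∪ R))
    (hd : Disjoint R Z) : X \ Z = ((X \ (Z ∪ R)) \ M) ∪ (M ∪ R) := by
  ext x
  have h1 := @hR x
  have h2 := @hM x
  have h3 : x ∈ R → x ∉ Z := fun h => disjoint_left.1 hd h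
  simp only [mem_sdiff, mem_union, not_or] at h1 h2 ⊢
  tauto

/-- If almost perfect packings exist after deleting few vertices, absorbing sets exist, and the
lattice has small index, then any solution packing extends to a perfect packing. -/
lemma packable_of_absorbing_sets {X : Finset α} {C : Set (Finset α)} {col : α → Fin d}
    {m r D q : ℕ} {B : ℝ} {L : AddSubgroup (Fin d → ℤ)} (hm : 1 ≤ m)
    (hC : ∀ A ∈ C, A ⊆ X ∧ #A = m)
    (habs : ∀ Z : Finset α, (#Z : ℝ) + r ≤ B → ∃ R ⊆ X, Disjoint R Z ∧ #R ≤ r ∧ Packable C R ∧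
      ∀ u ∈ {u ∈ X.powerset | #u ≤ D + q * m ∧ idx col u ∈ L}, Disjoint u R →
        Packable C (u ∪ R))
    (halmost : ∀ Z ⊆ X, (#Z : ℝ) ≤ B → ∃ M : Finset (Finset α), (∀ A ∈ M, A ∈ C) ∧
      (M : Set (Finset α)).PairwiseDisjoint id ∧ M.biUnion id ⊆ X \ Z ∧
      #((X \ Z) \ M.biUnion id) ≤ D)
    (hgrp : ∀ M : Finset (Finset α), (∀ A ∈ M, A ∈ C) → ∃ N ⊆ M, #N ≤ q ∧
      ∑ A ∈ M, idx col A - ∑ A ∈ N, idx col A ∈ L)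
    {M₁ : Finset (Finset α)} (hM₁ : ∀ A ∈ M₁, A ∈ C)
    (hM₁d : (M₁ : Set (Finset α)).PairwiseDisjoint id) (hM₁q : #M₁ ≤ q)
    (hM₁L : idx col (X \ M₁.biUnion id) ∈ L)
    (hB : ((q * m : ℕ) : ℝ) + ((q + 1 : ℕ) : ℝ) * r ≤ B) :
    Packable C X := by
  set Z₁ := M₁.biUnion id with hZ₁
  have hZ₁X : Z₁ ⊆ X := biUnion_subset.2 fun A hA => (hC A (hM₁ A hA)).1
  have hZ₁c : #Z₁ ≤ q * m :=
    (card_biUnion_le_card_mul M₁ id m fun A hA => (hC A (hM₁ A hA)).2.le).trans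
      (Nat.mul_le_mul_right _ hM₁q)
  have hZ₁c' : (#Z₁ : ℝ) ≤ ((q * m : ℕ) : ℝ) := Nat.cast_le.2 hZ₁c
  -- One more than the number of copies that may later be broken up.
  obtain ⟨R, hR, hRd⟩ := exists_disjoint_absorbing_sets habs (q + 1) Z₁ (by linarith)
  have hRp : ∀ j ∈ range (q + 1), ∃ N : Finset (Finset α), (∀ A ∈ N, A ∈ C) ∧
      (N : Set (Finset α)).PairwiseDisjoint id ∧ N.biUnion id = R j :=
    fun j hj => (hR j hj).2.2.2.1
  choose! N hNC hNd hNR using hRp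
  set RR := (range (q + 1)).biUnion R with hRR
  have hRRX : RR ⊆ X := biUnion_subset.2 fun j hj => (hR j hj).1
  have hRRZ : Disjoint RR Z₁ := (disjoint_biUnion_left _ _ _).2 fun j hj => (hR j hj).2.1
  have hRRc : #RR ≤ (q + 1) * r := by
    simpa using card_biUnion_le_card_mul (range (q + 1)) R r fun j hj => (hR j hj).2.2.1
  obtain ⟨M₂, hM₂, hM₂d, hM₂X, hM₂D⟩ := halmost (Z₁ ∪ RR) (union_subset hZ₁X hRRX) (by
    have h1 : (#(Z₁ ∪ RR) : ℝ) ≤ #Z₁ + #RR := by exact_mod_cast card_union_le _ _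
    have h2 : (#RR : ℝ) ≤ ((q + 1 : ℕ) : ℝ) * r := by exact_mod_cast hRRc
    linarith)
  set U₀ := (X \ (Z₁ ∪ RR)) \ M₂.biUnion id with hU₀
  set NN := (range (q + 1)).biUnion N with hNN
  have hNNR : NN.biUnion id = RR := by
    rw [hNN, biUnion_biUnion]
    exact biUnion_congr rfl hNR
  have hNNd : (NN : Set (Finset α)).PairwiseDisjoint id := by
    intro A hA A' hA' hne
    simp only [hNN, coe_biUnion, Set.mem_iUnion, mem_coe] at hA hA'
    obtain ⟨j, hj, hAj⟩ := hA
    obtain ⟨l, hl, hAl⟩ := hA'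
    by_cases hjl : j = l
    · subst hjl
      exact hNd j hj hAj hAl hne
    · refine (hRd (mem_coe.2 hj) (mem_coe.2 hl) hjl).mono ?_ ?_
      · rw [← hNR j hj]; exact subset_biUnion_of_mem id hAj
      · rw [← hNR l hl]; exact subset_biUnion_of_mem id hAl
  have hM₂R : Disjoint (M₂.biUnion id) (NN.biUnion id) := by
    rw [hNNR]
    refine disjoint_left.2 fun x hx hxR => ?_
    have := hM₂X hx
    simp only [mem_sdiff, mem_union, not_or] at this
    exact this.2.2 hxR
  set MM := M₂ ∪ NN with hMM
  have hMMC : ∀ A ∈ MM, A ∈ C := by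
    intro A hA
    rcases mem_union.1 hA with hA | hA
    · exact hM₂ A hA
    · obtain ⟨j, hj, hA⟩ := mem_biUnion.1 hA
      exact hNC j hj A hA
  have hMMd : (MM : Set (Finset α)).PairwiseDisjoint id := pairwiseDisjoint_union hM₂d hNNd hM₂R
  have hMMu : MM.biUnion id = M₂.biUnion id ∪ RR := by rw [hMM, union_biUnion, hNNR]
  -- The index vector of `X \ Z₁` is that of `U₀` plus the sum over `MM`, and it lies in `L`.
  -- Replacing the sum over `MM` by that over `T` stays in `L`, so returning only the copies in `T`
  -- to the leftover corrects its coset.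
  obtain ⟨T, hTM, hTq, hTL⟩ := hgrp MM hMMC
  set U' := U₀ ∪ T.biUnion id with hU'
  have hTMu : T.biUnion id ⊆ MM.biUnion id := biUnion_subset_biUnion_of_subset_left _ hTM
  have hMMX : MM.biUnion id ⊆ X := biUnion_subset.2 fun A hA => (hC A (hMMC A hA)).1
  have hU₀M : Disjoint U₀ (MM.biUnion id) := by
    rw [hMMu]
    refine disjoint_left.2 fun x hx hx' => ?_
    simp only [hU₀, mem_sdiff, mem_union, not_or] at hx hx'
    tauto
  have hXZ : X \ Z₁ = U₀ ∪ MM.biUnion id := by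
    rw [hMMu]
    exact sdiff_eq_sdiff_sdiff_union hRRX hM₂X hRRZ
  have hidx : idx col U' ∈ L := by
    rw [hXZ, idx_union col hU₀M, idx_biUnion col hMMd] at hM₁L
    rw [hU', idx_union col (hU₀M.mono_right hTMu),
      idx_biUnion col (hMMd.subset (coe_subset.2 hTM))]
    have := L.sub_mem hM₁L hTL
    convert this using 1
    abel
  have hU'c : #U' ≤ D + q * m := by
    have h1 : #(T.biUnion id) ≤ #T * m :=
      card_biUnion_le_card_mul T id m fun A hA => (hC A (hMMC A (hTM hA))).2.le
    have h2 : #T * m ≤ q * m := Nat.mul_le_mul_right _ hTq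
    have h3 : #U' ≤ #U₀ + #(T.biUnion id) := card_union_le _ _
    omega
  have hU'X : U' ⊆ X :=
    union_subset (sdiff_subset.trans sdiff_subset) (hTMu.trans hMMX)
  -- some absorbing set is left untouched
  obtain ⟨j, hj, hjT⟩ : ∃ j ∈ range (q + 1), Disjoint T (N j) := by
    by_contra! hcon
    simp only [Finset.not_disjoint_iff] at hcon
    choose! f hfT hfN using hcon
    -- A member of both `N a` and `N b` would lie inside two disjoint absorbing sets and be empty,
    -- contrary to `1 ≤ m`. Hence `T` would have at least `q + 1` members.
    have hinj : Set.InjOn f (range (q + 1) : Set ℕ) := by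
      intro a ha b hb hab
      by_contra hne
      have h1 : f a ⊆ R a := by
        rw [← hNR a ha]; exact subset_biUnion_of_mem id (hfN a ha)
      have h2 : f a ⊆ R b := by
        rw [hab, ← hNR b hb]; exact subset_biUnion_of_mem id (hfN b hb)
      have h3 : f a = ∅ := disjoint_self_iff_empty _ |>.1 ((hRd ha hb hne).mono h1 h2)
      have h4 := (hC _ (hMMC _ (hTM (hfT a ha)))).2
      rw [h3, card_empty] at h4
      omega
    have := card_le_card_of_injOn f (fun a ha => hfT a ha) hinj
    rw [card_range] at this
    omega
  have hNjM : N j ⊆ MM := (subset_biUnion_of_mem N hj).trans subset_union_right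
  have hdisj : ∀ S T' : Finset (Finset α), S ⊆ MM → T' ⊆ MM → Disjoint S T' →
      Disjoint (S.biUnion id) (T'.biUnion id) := by
    intro S T' hS hT' hST
    rw [disjoint_biUnion_left]
    intro A hA
    rw [disjoint_biUnion_right]
    intro A' hA'
    exact hMMd (hS hA) (hT' hA') (fun h => disjoint_left.1 hST hA (h ▸ hA'))
  have hU'R : Disjoint U' (R j) := by
    rw [hU', disjoint_union_left, ← hNR j hj]
    exact ⟨hU₀M.mono_right (biUnion_subset_biUnion_of_subset_left _ hNjM),
      hdisj _ _ hTM hNjM hjT⟩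
  have hP := (hR j hj).2.2.2.2 U' (mem_filter.2 ⟨mem_powerset.2 hU'X, hU'c, hidx⟩) hU'R
  -- All other copies are kept, including those in the packings of the other absorbing sets.
  set O := MM \ (T ∪ N j) with hO
  have hOM : O ⊆ MM := sdiff_subset
  have hOP : Packable C (O.biUnion id) :=
    ⟨O, fun A hA => hMMC A (hOM hA), hMMd.subset (coe_subset.2 hOM), rfl⟩
  have hOd : Disjoint (U' ∪ R j) (O.biUnion id) := by
    have h1 : Disjoint (T ∪ N j) O := disjoint_sdiff
    rw [disjoint_union_left] at h1
    rw [hU', disjoint_union_left, disjoint_union_left]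
    refine ⟨⟨hU₀M.mono_right (biUnion_subset_biUnion_of_subset_left _ hOM),
      hdisj _ _ hTM hOM h1.1⟩, ?_⟩
    rw [← hNR j hj]
    exact hdisj _ _ hNjM hOM h1.2
  have hall : U' ∪ R j ∪ O.biUnion id = X \ Z₁ := by
    have h1 : MM = T ∪ N j ∪ O := (union_sdiff_of_subset (union_subset hTM hNjM)).symm
    rw [hXZ, h1, union_biUnion, union_biUnion, hNR j hj, hU']
    simp only [union_assoc]
  have hfin := (hP.union hOP hOd)
  rw [hall] at hfin
  have := hfin.union ⟨M₁, hM₁, hM₁d, rfl⟩ (sdiff_disjoint)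
  rwa [sdiff_union_of_subset hZ₁X] at this

end Core

end SetPacking

/-! ### Uniform constants and the criterion for set families -/

namespace SetPacking

open Filter in
/-- Polynomially many sets can be exhausted by linearly few steps. -/
lemma eventually_exists_steps {ρ θ : ℝ} (hρ0 : 0 ≤ ρ) (hρ1 : ρ < 1) (hθ : 0 < θ)
    (a e Q w : ℕ) :
    ∀ᶠ n : ℕ in atTop, ∃ K : ℕ, ((a : ℝ) + 1) * (n : ℝ) ^ a * ρ ^ K < 1 ∧
      (e : ℝ) + Q * (K * w) ≤ θ * n := by
  -- Logarithmically many steps would suffice. Taking `⌊κ n⌋` makes the decay exponential in `n`,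
  -- while this `κ` keeps the total cost below `θ n / 2`.
  set κ : ℝ := θ / (2 * (Q * w + 1)) with hκ
  have hκpos : 0 < κ := by positivity
  have h1 : Tendsto (fun K : ℕ => ((a : ℝ) + 1) * (2 / κ) ^ a * ((K : ℝ) ^ a * ρ ^ K))
      atTop (nhds 0) := by
    simpa using (tendsto_pow_const_mul_const_pow_of_lt_one a hρ0 hρ1).const_mul
      (((a : ℝ) + 1) * (2 / κ) ^ a)
  have h2 : Tendsto (fun n : ℕ => ⌊κ * (n : ℝ)⌋₊) atTop atTop :=
    tendsto_nat_floor_atTop.comp (tendsto_natCast_atTop_atTop.const_mul_atTop hκpos)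
  have h3 := (h1.comp h2).eventually (gt_mem_nhds zero_lt_one)
  have h4 := h2.eventually (eventually_ge_atTop 1)
  have h5 : ∀ᶠ n : ℕ in atTop, 2 * (e : ℝ) / θ ≤ n :=
    tendsto_natCast_atTop_atTop.eventually (eventually_ge_atTop _)
  filter_upwards [h3, h4, h5] with n h3 h4 h5
  refine ⟨⌊κ * (n : ℝ)⌋₊, ?_, ?_⟩
  · refine lt_of_le_of_lt ?_ h3
    simp only [Function.comp]
    set K := ⌊κ * (n : ℝ)⌋₊ with hK
    have h6 : (n : ℝ) ≤ 2 / κ * K := by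
      have h7 : κ * n < K + 1 := Nat.lt_floor_add_one _
      have h8 : (1 : ℝ) ≤ K := by exact_mod_cast h4
      rw [div_mul_eq_mul_div, le_div_iff₀ hκpos]
      linarith
    calc ((a : ℝ) + 1) * (n : ℝ) ^ a * ρ ^ K
        ≤ ((a : ℝ) + 1) * (2 / κ * K) ^ a * ρ ^ K := by gcongr
      _ = _ := by rw [mul_pow]; ring
  · have h6 : (⌊κ * (n : ℝ)⌋₊ : ℝ) ≤ κ * n := Nat.floor_le (by positivity)
    have h7 : (Q : ℝ) * (⌊κ * (n : ℝ)⌋₊ * w) ≤ θ * n / 2 := by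
      calc (Q : ℝ) * (⌊κ * (n : ℝ)⌋₊ * w) ≤ Q * (κ * n * w) := by gcongr
        _ = κ * (Q * w) * n := by ring
        _ ≤ κ * (Q * w + 1) * n := by gcongr; linarith
        _ = θ * n / 2 := by rw [hκ]; field_simp
    rw [div_le_iff₀ hθ] at h5
    linarith

/-- Negative terms are moved to the other side because both sums must later be index vectors of
actual vertex sets. -/
lemma exists_lists_of_mem_closure {G : Type*} [AddCommGroup G] {I : Set G} {u : G}
    (hu : u ∈ AddSubgroup.closure I) :
    ∃ l₁ l₂ : List G, (∀ v ∈ l₁, v ∈ I) ∧ (∀ v ∈ l₂, v ∈ I) ∧ u + l₂.sum = l₁.sum := by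
  induction hu using AddSubgroup.closure_induction with
  | mem x hx => exact ⟨[x], [], by simpa using hx, by simp, by simp⟩
  | zero => exact ⟨[], [], by simp, by simp, by simp⟩
  | add x y _ _ hx hy =>
    obtain ⟨l₁, l₂, h₁, h₂, h⟩ := hx
    obtain ⟨k₁, k₂, g₁, g₂, g⟩ := hy
    refine ⟨l₁ ++ k₁, l₂ ++ k₂, ?_, ?_, ?_⟩
    · intro v hv
      rcases List.mem_append.1 hv with hv | hv
      exacts [h₁ v hv, g₁ v hv]
    · intro v hv
      rcases List.mem_append.1 hv with hv | hv
      exacts [h₂ v hv, g₂ v hv]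
    · rw [List.sum_append, List.sum_append, ← h, ← g]
      abel
  | neg x _ hx =>
    obtain ⟨l₁, l₂, h₁, h₂, h⟩ := hx
    exact ⟨l₂, l₁, h₂, h₁, by rw [← h]; abel⟩

open Filter in
/-- Bounded vectors in a lattice generated by bounded vectors are bounded combinations of the
generators. -/
lemma exists_lists_length_le (e m D : ℕ) :
    ∃ c : ℕ, ∀ d ≤ e, ∀ I : Set (Fin d → ℤ), (∀ v ∈ I, ∀ i, 0 ≤ v i ∧ v i ≤ m) →
      ∀ u ∈ AddSubgroup.closure I, (∀ i, 0 ≤ u i ∧ u i ≤ D) →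
        ∃ l₁ l₂ : List (Fin d → ℤ), (∀ v ∈ l₁, v ∈ I) ∧ (∀ v ∈ l₂, v ∈ I) ∧ l₁.length ≤ c ∧
          l₂.length ≤ c ∧ u + l₂.sum = l₁.sum := by
  -- For each `d ≤ e` there are finitely many generating sets in the box and finitely many bounded
  -- vectors, so one `c` serves them all.
  have key : ∀ᶠ c : ℕ in atTop, ∀ d ∈ Set.Iic e,
      ∀ I ∈ (Set.Icc (0 : Fin d → ℤ) (fun _ => (m : ℤ))).powerset,
      ∀ u ∈ Set.Icc (0 : Fin d → ℤ) (fun _ => (D : ℤ)), u ∈ AddSubgroup.closure I →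
        ∃ l₁ l₂ : List (Fin d → ℤ), (∀ v ∈ l₁, v ∈ I) ∧ (∀ v ∈ l₂, v ∈ I) ∧ l₁.length ≤ c ∧
          l₂.length ≤ c ∧ u + l₂.sum = l₁.sum := by
    refine (eventually_all_finite (Set.finite_Iic e)).2 fun d _ => ?_
    refine (eventually_all_finite (Set.finite_Icc _ _).powerset).2 fun I _ => ?_
    refine (eventually_all_finite (Set.finite_Icc _ _)).2 fun u _ => ?_
    by_cases hu : u ∈ AddSubgroup.closure I
    · obtain ⟨l₁, l₂, h₁, h₂, h⟩ := exists_lists_of_mem_closure hu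
      filter_upwards [eventually_ge_atTop l₁.length, eventually_ge_atTop l₂.length] with c hc hc'
      exact fun _ => ⟨l₁, l₂, h₁, h₂, hc, hc', h⟩
    · exact Eventually.of_forall fun _ h => absurd h hu
  obtain ⟨c, hc⟩ := key.exists
  refine ⟨c, fun d hd I hI u hu hub => hc d hd I ?_ u ?_ hu⟩
  · exact fun v hv => ⟨fun i => (hI v hv i).1, fun i => (hI v hv i).2⟩
  · exact ⟨fun i => (hub i).1, fun i => (hub i).2⟩

section Core

open scoped Classical

variable {α : Type*} {d : ℕ}

/-- Bounds the sets to be absorbed by a polynomial in `#X`, which the decay `(1 - η) ^ K` beats. -/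
lemma card_powerset_card_le {X : Finset α} (hX : X.Nonempty) (D : ℕ) (p : Finset α → Prop) :
    (#{u ∈ X.powerset | #u ≤ D ∧ p u} : ℝ) ≤ ((D : ℝ) + 1) * (#X : ℝ) ^ D := by
  have h1 : {u ∈ X.powerset | #u ≤ D ∧ p u} ⊆ (range (D + 1)).biUnion (fun j => powersetCard j X) := by
    intro u hu
    simp only [mem_filter, mem_powerset] at hu
    simp only [mem_biUnion, mem_range, mem_powersetCard]
    exact ⟨#u, Nat.lt_succ_of_le hu.2.1, hu.1, rfl⟩
  have h2 : #{u ∈ X.powerset | #u ≤ D ∧ p u} ≤ (D + 1) * #X ^ D := by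
    refine (card_le_card h1).trans ?_
    refine (card_biUnion_le_card_mul _ _ (#X ^ D) fun j hj => ?_).trans (by rw [card_range])
    rw [card_powersetCard]
    exact (Nat.choose_le_pow _ _).trans
      (Nat.pow_le_pow_right hX.card_pos (Nat.le_of_lt_succ (mem_range.1 hj)))
  exact_mod_cast h2

/-- The perfect packing criterion for set families. -/
lemma packable_of_solution {X : Finset α} {C : Set (Finset α)} {col : α → Fin d}
    {m s D q c e K : ℕ} {θ η : ℝ} {I : Set (Fin d → ℤ)} (hm : 1 ≤ m) (hθ : 0 < θ) (hθ1 : θ ≤ 1)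
    (hX : X.Nonempty) (hd : d ≤ e) (hη : η = θ ^ (m * c) / (((D + q * m : ℕ) : ℝ) + 1) ^ e)
    (hK : (((D + q * m : ℕ) : ℝ) + 1) * (#X : ℝ) ^ (D + q * m) * (1 - η) ^ K < 1)
    (hKB : ((q * m : ℕ) : ℝ) + ((q + 1 : ℕ) : ℝ) * (K * (2 * (m * c) + m * c * s : ℕ)) ≤ θ * #X)
    (hC : ∀ A ∈ C, A ⊆ X ∧ #A = m)
    (hcol : ∀ x ∈ X, ∃ y ∈ X, y ≠ x ∧ col y = col x)
    (hreach : ∀ x ∈ X, ∀ y ∈ X, x ≠ y → col x = col y → 2 * θ * (#X : ℝ) ^ s ≤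
      (#{S ∈ powersetCard s X | Packable C (insert x S) ∧ Packable C (insert y S)} : ℝ))
    (hI : ∀ v ∈ I, ∀ Z : Finset α, (#Z : ℝ) ≤ θ * #X → ∃ A ∈ C, Disjoint A Z ∧ idx col A = v)
    (hrep : ∀ u ∈ AddSubgroup.closure I, (∀ i, 0 ≤ u i ∧ u i ≤ (D + q * m : ℕ)) →
      ∃ l₁ l₂ : List (Fin d → ℤ), (∀ v ∈ l₁, v ∈ I) ∧ (∀ v ∈ l₂, v ∈ I) ∧ l₁.length ≤ c ∧
        l₂.length ≤ c ∧ u + l₂.sum = l₁.sum)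
    (halmost : ∀ Z ⊆ X, (#Z : ℝ) ≤ θ * #X → ∃ M : Finset (Finset α), (∀ A ∈ M, A ∈ C) ∧
      (M : Set (Finset α)).PairwiseDisjoint id ∧ M.biUnion id ⊆ X \ Z ∧
      #((X \ Z) \ M.biUnion id) ≤ D)
    (hgrp : ∀ M : Finset (Finset α), (∀ A ∈ M, A ∈ C) → ∃ N ⊆ M, #N ≤ q ∧
      ∑ A ∈ M, idx col A - ∑ A ∈ N, idx col A ∈ AddSubgroup.closure I)
    {M₁ : Finset (Finset α)} (hM₁ : ∀ A ∈ M₁, A ∈ C)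
    (hM₁d : (M₁ : Set (Finset α)).PairwiseDisjoint id) (hM₁q : #M₁ ≤ q)
    (hM₁L : idx col (X \ M₁.biUnion id) ∈ AddSubgroup.closure I) :
    Packable C X := by
  have h1D : (1 : ℝ) ≤ ((D + q * m : ℕ) : ℝ) + 1 := by
    linarith [Nat.cast_nonneg (α := ℝ) (D + q * m)]
  have hη1 : η ≤ 1 := by
    rw [hη]
    exact div_le_one_of_le₀ ((pow_le_one₀ hθ.le hθ1).trans (one_le_pow₀ h1D)) (by positivity)
  refine packable_of_absorbing_sets (r := K * (2 * (m * c) + m * c * s)) (B := θ * #X) hm hC ?_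
    halmost hgrp hM₁ hM₁d hM₁q hM₁L (by push_cast at hKB ⊢; linarith)
  intro Z hZ
  refine exists_absorbing_set (w := 2 * (m * c) + m * c * s) (η := η) (B := θ * #X) hη1
    (good := fun u => u ⊆ X ∧ #u ≤ D + q * m ∧ idx col u ∈ AddSubgroup.closure I) ?_ K _
    (fun u hu => by simpa using hu) ?_ Z (by push_cast at hZ ⊢; linarith)
  · intro U hU hUX Z hZ
    obtain ⟨W, hWX, hWZ, hWc, hW, hWU⟩ := exists_absorber hθ hθ1 hX hC hcol hreach hI hrep hU hUX Z hZ
    refine ⟨W, hWX, hWZ, hWc, hW, le_trans ?_ hWU⟩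
    -- Using the exponent `e ≥ d` only lowers the proportion and makes `η` independent of the number
    -- of parts.
    rw [hη]
    gcongr
  · refine lt_of_le_of_lt ?_ hK
    have h0 : 0 ≤ (1 - η) ^ K := pow_nonneg (by linarith) _
    gcongr
    exact card_powerset_card_le hX (D + q * m) (fun u => idx col u ∈ AddSubgroup.closure I)

/-- The index vector of an `m`-set has coordinate sum `m`, hence defines a coset, and
`exists_subset_card_le_sum_eq` applies in the coset group. Both directions of the theorem use this.
-/
lemma exists_sum_sub_mem_of_card_le {C : Set (Finset α)} {col : α → Fin d} {m q : ℕ}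
    {L : AddSubgroup (Fin d → ℤ)} (hC : ∀ A ∈ C, #A = m)
    (hL : ENat.card (Hypergraph.CosetGroup m L) ≤ (q : ℕ∞)) (M : Finset (Finset α))
    (hM : ∀ A ∈ M, A ∈ C) :
    ∃ N ⊆ M, #N ≤ q ∧ ∑ A ∈ M, idx col A - ∑ A ∈ N, idx col A ∈ L := by
  have hfin : Finite (Hypergraph.CosetGroup m L) := by
    rw [← ENat.card_lt_top]
    exact hL.trans_lt (ENat.natCast_lt_top q)
  have hcard : Nat.card (Hypergraph.CosetGroup m L) ≤ q := by
    rw [ENat.card_eq_coe_natCard] at hL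
    exact_mod_cast hL
  let g : Finset α → Hypergraph.maxLattice d m := fun A =>
    if h : idx col A ∈ Hypergraph.maxLattice d m then ⟨idx col A, h⟩ else 0
  have hg : ∀ A ∈ M, (g A : Fin d → ℤ) = idx col A := by
    intro A hA
    have h : idx col A ∈ Hypergraph.maxLattice d m := by
      change (m : ℤ) ∣ ∑ i, idx col A i
      rw [sum_idx, hC A (hM A hA)]
    simp only [g, dif_pos h]
  obtain ⟨N, hN, hNq, hNs⟩ := exists_subset_card_le_sum_eq hcard M
    (fun A => (QuotientAddGroup.mk' (L.addSubgroupOf (Hypergraph.maxLattice d m))) (g A))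
  refine ⟨N, hN, hNq, ?_⟩
  rw [← map_sum, ← map_sum, QuotientAddGroup.mk'_apply, QuotientAddGroup.mk'_apply,
    QuotientAddGroup.eq, AddSubgroup.mem_addSubgroupOf] at hNs
  have h1 : ((∑ A ∈ M, g A : Hypergraph.maxLattice d m) : Fin d → ℤ) = ∑ A ∈ M, idx col A := by
    rw [AddSubgroup.val_finsetSum]
    exact sum_congr rfl hg
  have h2 : ((∑ A ∈ N, g A : Hypergraph.maxLattice d m) : Fin d → ℤ) = ∑ A ∈ N, idx col A := by
    rw [AddSubgroup.val_finsetSum]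
    exact sum_congr rfl fun A hA => hg A (hN hA)
  rw [AddSubgroup.coe_add, AddSubgroup.coe_neg, h1, h2] at hNs
  rwa [sub_eq_neg_add]

/-- The necessity direction: the vertices outside the short subpacking have index vector equal to
the difference of the two sums. -/
lemma exists_solution_of_packable {X : Finset α} {C : Set (Finset α)} {col : α → Fin d} {q : ℕ}
    {L : AddSubgroup (Fin d → ℤ)}
    (hgrp : ∀ M : Finset (Finset α), (∀ A ∈ M, A ∈ C) → ∃ N ⊆ M, #N ≤ q ∧
      ∑ A ∈ M, idx col A - ∑ A ∈ N, idx col A ∈ L) (h : Packable C X) :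
    ∃ N : Finset (Finset α), (∀ A ∈ N, A ∈ C) ∧ (N : Set (Finset α)).PairwiseDisjoint id ∧
      #N ≤ q ∧ idx col (X \ N.biUnion id) ∈ L := by
  obtain ⟨M, hM, hMd, rfl⟩ := h
  obtain ⟨N, hN, hNq, hNL⟩ := hgrp M hM
  have hNd := hMd.subset (coe_subset.2 hN)
  refine ⟨N, fun A hA => hM A (hN hA), hNd, hNq, ?_⟩
  have h1 := idx_union col (sdiff_disjoint : Disjoint (M.biUnion id \ N.biUnion id) (N.biUnion id))
  rw [sdiff_union_of_subset (biUnion_subset_biUnion_of_subset_left _ hN), idx_biUnion col hMd,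
    idx_biUnion col hNd] at h1
  rwa [h1, add_sub_cancel_right] at hNL

/-- Settles the case of an edgeless `F`, where divisibility is enough. -/
lemma packable_of_forall_card_mem {C : Set (Finset α)} {X : Finset α} {m : ℕ}
    (hC : ∀ A ⊆ X, #A = m → A ∈ C) (hX : m ∣ #X) : Packable C X := by
  obtain ⟨j, hj⟩ := hX
  induction j generalizing X with
  | zero =>
    rw [mul_zero, card_eq_zero] at hj
    exact hj ▸ packable_empty C
  | succ j ih =>
    obtain ⟨A, hA, hAm⟩ := exists_subset_card_eq (s := X) (n := m) (by rw [hj]; nlinarith)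
    have h1 := ih (X := X \ A) (fun B hB => hC B (hB.trans sdiff_subset))
      (by rw [card_sdiff_of_subset hA, hj, hAm, mul_add, mul_one, Nat.add_sub_cancel])
    have := h1.union (packable_of_mem (hC A hA hAm)) sdiff_disjoint
    rwa [sdiff_union_of_subset hA] at this

end Core

end SetPacking

/-! ### From copies of `F` to families of vertex sets -/

namespace Hypergraph

section Copies

variable {α β γ : Type*}

lemma image_congr (F : Hypergraph β) {f g : β → α} (h : Set.EqOn f g F.vertexSet) :
    F.image f = F.image g := by
  ext x
  · simp only [image_vertexSet]
    rw [Set.image_congr h]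
  · simp only [mem_edgeSet_image]
    constructor
    · rintro ⟨e, he, rfl⟩
      exact ⟨e, he, (Set.image_congr (h.mono (F.subset_vertexSet_of_mem_edgeSet' he))).symm⟩
    · rintro ⟨e, he, rfl⟩
      exact ⟨e, he, Set.image_congr (h.mono (F.subset_vertexSet_of_mem_edgeSet' he))⟩

/-- Whether a hypergraph is a copy of `F` depends only on the isomorphism class of `F`. -/
lemma isCopyIn_image_iff {F : Hypergraph β} {g : β → γ} (hg : Set.InjOn g F.vertexSet)
    (hF : F.vertexSet.Nonempty) (H G : Hypergraph α) : IsCopyIn (F.image g) H G ↔ IsCopyIn F H G := by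
  constructor
  · rintro ⟨hv, he, f, hf, rfl⟩
    exact ⟨hv, he, f ∘ g, hf.comp hg (Set.mapsTo_image g _), image_image F⟩
  · rintro ⟨hv, he, f, hf, rfl⟩
    refine ⟨hv, he, ?_⟩
    have : Nonempty β := ⟨hF.some⟩
    have hinv : Set.EqOn (f ∘ Function.invFunOn g F.vertexSet ∘ g) f F.vertexSet :=
      fun x hx => congrArg f (hg.leftInvOn_invFunOn hx)
    refine ⟨f ∘ Function.invFunOn g F.vertexSet, ?_, ?_⟩
    · rintro _ ⟨x, hx, rfl⟩ _ ⟨y, hy, rfl⟩ hxy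
      have h1 := hinv hx
      have h2 := hinv hy
      simp only [Function.comp] at h1 h2 hxy
      rw [h1, h2] at hxy
      rw [hf hx hy hxy]
    · rw [image_image]
      exact (image_congr F hinv).symm

lemma IsCopyIn.finite {F : Hypergraph β} {H G : Hypergraph α} (h : IsCopyIn F H G)
    (hF : F.vertexSet.Finite) : G.vertexSet.Finite := by
  obtain ⟨-, -, f, -, rfl⟩ := h
  exact hF.image f

lemma IsCopyIn.ncard_vertexSet {F : Hypergraph β} {H G : Hypergraph α} (h : IsCopyIn F H G) :
    G.vertexSet.ncard = F.vertexSet.ncard := by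
  obtain ⟨-, -, f, hf, rfl⟩ := h
  exact hf.ncard_image

lemma isCopyIn_induce_iff {F : Hypergraph β} {H G : Hypergraph α} {S : Set α} :
    IsCopyIn F (H.induce S) G ↔ IsCopyIn F H G ∧ G.vertexSet ⊆ S := by
  constructor
  · rintro ⟨hv, he, hf⟩
    exact ⟨⟨hv.trans Set.inter_subset_left, fun e h => (he h).1, hf⟩,
      hv.trans Set.inter_subset_right⟩
  · rintro ⟨⟨hv, he, hf⟩, hS⟩
    exact ⟨Set.subset_inter hv hS,
      fun e h => ⟨he h, (G.subset_vertexSet_of_mem_edgeSet' h).trans hS⟩, hf⟩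

/-- The vertex sets of the copies of `F` in `H`. -/
def copySets (F : Hypergraph β) (H : Hypergraph α) : Set (Finset α) :=
  {A | ∃ G, IsCopyIn F H G ∧ G.vertexSet = A}

-- Together with `exists_isPacking`, this lets packings be replaced by disjoint vertex sets: the
-- size does not grow and the covered set is unchanged.
open scoped Classical in
lemma IsPacking.exists_finset {F : Hypergraph β} {H : Hypergraph α} {M : Finset (Hypergraph α)}
    (hF : F.vertexSet.Finite) (h : IsPacking F H M) :
    ∃ N : Finset (Finset α), (∀ A ∈ N, A ∈ copySets F H) ∧
      (N : Set (Finset α)).PairwiseDisjoint id ∧ #N ≤ #M ∧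
      ((N.biUnion id : Finset α) : Set α) = covered M := by
  have hfin : ∀ G ∈ M, ∃ A : Finset α, (A : Set α) = G.vertexSet := fun G hG =>
    ((h.1 G hG).finite hF).exists_finset_coe
  choose! f hf using hfin
  refine ⟨M.image f, ?_, ?_, card_image_le, ?_⟩
  · intro A hA
    obtain ⟨G, hG, rfl⟩ := mem_image.1 hA
    exact ⟨G, h.1 G hG, (hf G hG).symm⟩
  · intro A hA B hB hne
    obtain ⟨G, hG, rfl⟩ := mem_image.1 (mem_coe.1 hA)
    obtain ⟨G', hG', rfl⟩ := mem_image.1 (mem_coe.1 hB)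
    have := h.2 hG hG' (fun h => hne (h ▸ rfl))
    simp only [Function.onFun, id]
    rw [← disjoint_coe, hf G hG, hf G' hG']
    exact this
  · rw [image_biUnion, coe_biUnion, covered]
    exact Set.iUnion₂_congr fun G hG => hf G hG

open scoped Classical in
lemma exists_isPacking {F : Hypergraph β} {H : Hypergraph α} {N : Finset (Finset α)}
    (hN : ∀ A ∈ N, A ∈ copySets F H) (hd : (N : Set (Finset α)).PairwiseDisjoint id) :
    ∃ M : Finset (Hypergraph α), IsPacking F H M ∧ #M ≤ #N ∧
      covered M = ((N.biUnion id : Finset α) : Set α) := by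
  have hN' : ∀ A ∈ N, ∃ G, IsCopyIn F H G ∧ G.vertexSet = A := hN
  have : Nonempty (Hypergraph α) := ⟨⊥⟩
  choose! f hf hfv using hN'
  refine ⟨N.image f, ⟨?_, ?_⟩, card_image_le, ?_⟩
  · intro G hG
    obtain ⟨A, hA, rfl⟩ := mem_image.1 hG
    exact hf A hA
  · intro G hG G' hG' hne
    obtain ⟨A, hA, rfl⟩ := mem_image.1 (mem_coe.1 hG)
    obtain ⟨B, hB, rfl⟩ := mem_image.1 (mem_coe.1 hG')
    have := hd hA hB (fun h => hne (h ▸ rfl))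
    simp only [Function.onFun]
    rw [hfv A hA, hfv B hB, disjoint_coe]
    exact this
  · ext x
    simp only [covered, mem_image, Set.mem_iUnion, exists_prop, coe_biUnion, mem_coe, id]
    constructor
    · rintro ⟨_, ⟨A, hA, rfl⟩, hx⟩
      exact ⟨A, hA, by rwa [hfv A hA] at hx⟩
    · rintro ⟨A, hA, hx⟩
      exact ⟨f A, ⟨A, hA, rfl⟩, by rwa [hfv A hA]⟩

open scoped Classical in
lemma hasPerfectPacking_iff {F : Hypergraph β} {H : Hypergraph α} (hF : F.vertexSet.Finite)
    {X : Finset α} (hX : (X : Set α) = H.vertexSet) :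
    HasPerfectPacking F H ↔ SetPacking.Packable (copySets F H) X := by
  constructor
  · rintro ⟨M, hM, hc⟩
    obtain ⟨N, hN, hNd, -, hNc⟩ := hM.exists_finset hF
    exact ⟨N, hN, hNd, by rw [← coe_inj, hNc, hc, hX]⟩
  · rintro ⟨N, hN, hNd, rfl⟩
    obtain ⟨M, hM, -, hMc⟩ := exists_isPacking hN hNd
    exact ⟨M, hM, by rw [hMc, hX]⟩

open scoped Classical in
lemma packable_of_hasPerfectPacking_induce {F : Hypergraph β} {H : Hypergraph α}
    (hF : F.vertexSet.Finite) {S : Finset α} (hS : (S : Set α) ⊆ H.vertexSet)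
    (h : HasPerfectPacking F (H.induce S)) : SetPacking.Packable (copySets F H) S := by
  have h1 := (hasPerfectPacking_iff hF (X := S) (Set.inter_eq_right.2 hS).symm).1 h
  obtain ⟨N, hN, hNd, hNS⟩ := h1
  refine ⟨N, fun A hA => ?_, hNd, hNS⟩
  obtain ⟨G, hG, hGA⟩ := hN A hA
  exact ⟨G, (isCopyIn_induce_iff.1 hG).1, hGA⟩

lemma card_of_mem_copySets {F : Hypergraph β} {H : Hypergraph α} {X A : Finset α}
    (hX : (X : Set α) = H.vertexSet) (hA : A ∈ copySets F H) :
    A ⊆ X ∧ #A = F.vertexSet.ncard := by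
  obtain ⟨G, hG, hGA⟩ := hA
  refine ⟨?_, ?_⟩
  · rw [← coe_subset, hX, ← hGA]
    exact hG.1
  · rw [← hG.ncard_vertexSet, hGA, Set.ncard_coe_finset]

lemma indexVector_coe {d : ℕ} {P : Fin d → Set α} {X S : Finset α} {col : α → Fin d}
    (hcol : ∀ x ∈ X, ∀ i, x ∈ P i ↔ col x = i) (hS : S ⊆ X) :
    indexVector P (S : Set α) = SetPacking.idx col S := by
  classical
  funext i
  have : (S : Set α) ∩ P i = (({x ∈ S | col x = i} : Finset α) : Set α) := by
    ext x
    simp only [Set.mem_inter_iff, mem_coe, coe_filter, Set.mem_ofPred_eq]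
    exact and_congr_right fun hx => hcol x (hS hx) i
  simp only [indexVector, SetPacking.idx]
  rw [this, Set.ncard_coe_finset]

open scoped Classical in
/-- Robust index vectors are realised by copies that avoid any small set. -/
lemma exists_copySet_disjoint {F : Hypergraph β} {H : Hypergraph α} {X : Finset α} {d : ℕ}
    {P : Fin d → Set α} {col : α → Fin d} {μ θ : ℝ} (hX : (X : Set α) = H.vertexSet)
    (hF : F.vertexSet.Finite)
    (hXne : X.Nonempty) (hcol : ∀ x ∈ X, ∀ i, x ∈ P i ↔ col x = i)
    (hμ : θ * 2 ^ 2 ^ F.vertexSet.ncard < μ) {v : Fin d → ℤ}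
    (hv : v ∈ robustIndexVectors F H P μ) (Z : Finset α) (hZ : (#Z : ℝ) ≤ θ * #X) :
    ∃ A ∈ copySets F H, Disjoint A Z ∧ SetPacking.idx col A = v := by
  by_contra! hcon
  set m := F.vertexSet.ncard with hm
  -- If every copy of index `v` met `Z`, their vertex sets would all lie in `T`. Each supports at
  -- most `2 ^ 2 ^ m` hypergraphs, which is too few copies for `v` to be robust.
  set T := {S ∈ powersetCard m X | ¬ Disjoint S Z} with hT
  have hsub : {G | IsCopyIn F H G ∧ indexVector P G.vertexSet = v} ⊆
      ⋃ A ∈ T, {G : Hypergraph α | G.vertexSet = (A : Set α)} := by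
    rintro G ⟨hG, hGv⟩
    obtain ⟨A, hA⟩ := (hG.finite hF).exists_finset_coe
    have hAC : A ∈ copySets F H := ⟨G, hG, hA.symm⟩
    obtain ⟨hAX, hAm⟩ := card_of_mem_copySets hX hAC
    rw [← hA, indexVector_coe hcol hAX] at hGv
    have hAZ : ¬ Disjoint A Z := fun h => hcon A hAC h hGv
    simp only [Set.mem_iUnion, exists_prop]
    exact ⟨A, mem_filter.2 ⟨mem_powersetCard.2 ⟨hAX, hAm⟩, hAZ⟩, hA.symm⟩
  have hinj : ∀ A : Finset α, Set.InjOn Hypergraph.edgeSet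
      {G : Hypergraph α | G.vertexSet = (A : Set α)} := by
    intro A G hG G' hG' h
    exact Hypergraph.ext (Eq.trans hG (Eq.symm hG')) h
  have hmaps : ∀ A : Finset α, Set.MapsTo Hypergraph.edgeSet
      {G : Hypergraph α | G.vertexSet = (A : Set α)} ((A : Set α).powerset.powerset) := by
    intro A G hG e he
    have := G.subset_vertexSet_of_mem_edgeSet' he
    rwa [show G.vertexSet = A from hG] at this
  have hfinA : ∀ A : Finset α, ((A : Set α).powerset.powerset).Finite := fun A =>
    A.finite_toSet.powerset.powerset
  have hcardA : ∀ A ∈ T, {G : Hypergraph α | G.vertexSet = (A : Set α)}.ncard ≤ 2 ^ 2 ^ m := by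
    intro A hA
    refine (Set.ncard_le_ncard_of_injOn _ (hmaps A) (hinj A) (hfinA A)).trans ?_
    rw [Set.ncard_powerset _ A.finite_toSet.powerset, Set.ncard_powerset _ A.finite_toSet,
      Set.ncard_coe_finset, (mem_powersetCard.1 (mem_filter.1 hA).1).2]
  have h1 : {G | IsCopyIn F H G ∧ indexVector P G.vertexSet = v}.ncard ≤ #T * 2 ^ 2 ^ m := by
    refine (Set.ncard_le_ncard hsub ?_).trans ((Finset.set_ncard_biUnion_le T _).trans
      (sum_le_card_nsmul T _ _ hcardA))
    exact T.finite_toSet.biUnion fun A _ => Set.Finite.of_injOn (hmaps A) (hinj A) (hfinA A)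
  have h2 : (#T : ℝ) * #X ≤ #Z * (#X : ℝ) ^ m := by
    exact_mod_cast SetPacking.card_powersetCard_meeting_mul_le X Z m
  have hXpos : (0 : ℝ) < #X := by exact_mod_cast hXne.card_pos
  have h3 : μ * (#X : ℝ) ^ m ≤ #T * 2 ^ 2 ^ m := by
    have h4 : μ * (H.vertexSet.ncard : ℝ) ^ m ≤ _ := hv
    rw [← hX, Set.ncard_coe_finset] at h4
    refine h4.trans ?_
    exact_mod_cast h1
  have h5 : μ * (#X : ℝ) ^ m * #X ≤ θ * 2 ^ 2 ^ m * (#X : ℝ) ^ m * #X := by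
    calc μ * (#X : ℝ) ^ m * #X ≤ #T * 2 ^ 2 ^ m * #X := by gcongr
      _ = #T * #X * 2 ^ 2 ^ m := by ring
      _ ≤ #Z * (#X : ℝ) ^ m * 2 ^ 2 ^ m := by gcongr
      _ ≤ θ * #X * (#X : ℝ) ^ m * 2 ^ 2 ^ m := by gcongr
      _ = _ := by ring
  have h6 : 0 < (#X : ℝ) ^ m * #X := by positivity
  nlinarith

/-- Positive `μ` and `n` force an actual copy to exist. This places the generators in the finite box
needed by `exists_lists_length_le`. -/
lemma robustIndexVectors_bounds {F : Hypergraph β} {H : Hypergraph α} {d : ℕ}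
    {P : Fin d → Set α} {μ : ℝ} (hF : F.vertexSet.Finite) (hμ : 0 < μ)
    (hH : 0 < H.vertexSet.ncard) {v : Fin d → ℤ}
    (hv : v ∈ robustIndexVectors F H P μ) (i : Fin d) :
    0 ≤ v i ∧ v i ≤ F.vertexSet.ncard := by
  have h1 : (0 : ℝ) < {G | IsCopyIn F H G ∧ indexVector P G.vertexSet = v}.ncard :=
    lt_of_lt_of_le (by positivity) hv
  obtain ⟨G, hG, rfl⟩ := Set.nonempty_of_ncard_ne_zero (by exact_mod_cast h1.ne')
  refine ⟨by simp [indexVector], ?_⟩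
  rw [← hG.ncard_vertexSet]
  simp only [indexVector]
  exact_mod_cast Set.ncard_le_ncard Set.inter_subset_left (hG.finite hF)

open scoped Classical in
lemma IsReachable.le_card {F : Hypergraph β} {H : Hypergraph α} {X : Finset α} {b : ℝ} {t : ℕ}
    {x y : α} (hX : (X : Set α) = H.vertexSet) (hF : F.vertexSet.Finite) (hx : x ∈ X) (hy : y ∈ X)
    (h : IsReachable F H b t x y) :
    b * (#X : ℝ) ^ (t * F.vertexSet.ncard - 1) ≤
      (#{S ∈ powersetCard (t * F.vertexSet.ncard - 1) X |
        SetPacking.Packable (copySets F H) (insert x S) ∧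
        SetPacking.Packable (copySets F H) (insert y S)} : ℝ) := by
  set s := t * F.vertexSet.ncard - 1 with hs
  have h' : b * (H.vertexSet.ncard : ℝ) ^ s ≤ _ := h
  rw [← hX, Set.ncard_coe_finset] at h'
  refine h'.trans ?_
  rw [← Set.ncard_coe_finset]
  refine Nat.cast_le.2 ((Set.ncard_le_ncard (t := (fun S : Finset α => (S : Set α)) '' _) ?_
    ((Finset.finite_toSet _).image _)).trans (Set.ncard_image_le (Finset.finite_toSet _)))
  rintro S ⟨hSX, hSc, hSx, hSy⟩
  obtain ⟨S, rfl⟩ := (X.finite_toSet.subset hSX).exists_finset_coe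
  have hSX' : S ⊆ X := by exact_mod_cast hSX
  have hins : ∀ z ∈ X, HasPerfectPacking F (H.induce (S ∪ {z})) →
      SetPacking.Packable (copySets F H) (insert z S) := by
    intro z hz hp
    refine packable_of_hasPerfectPacking_induce hF ?_ ?_
    · rw [← hX, coe_subset]
      exact insert_subset hz hSX'
    · rwa [coe_insert, ← Set.union_singleton]
  rw [Set.ncard_coe_finset] at hSc
  refine ⟨S, ?_, rfl⟩
  simp only [coe_filter, mem_powersetCard, Set.mem_ofPred_eq]
  exact ⟨⟨hSX', hSc⟩, hins x hx hSx, hins y hy hSy⟩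

end Copies

end Hypergraph

/-! ### Minimum degrees and the almost packing threshold -/

namespace Hypergraph

variable {α β γ : Type*}

/-- The number of edges of a `k`-graph containing a given set of vertices is at most the number of
`k`-sets of vertices containing it. -/
lemma IsKGraph.setDegree_le {k : ℕ} {H : Hypergraph α} (hH : H.IsKGraph k) {S : Set α}
    (hS : S ⊆ H.vertexSet) :
    H.setDegree S ≤ (H.vertexSet.ncard - S.ncard).choose (k - S.ncard) := by
  classical
  have hSf := hH.1.subset hS
  obtain ⟨Y, hY⟩ := (hH.1.sdiff (t := S)).exists_finset_coe
  have hYc : #Y = H.vertexSet.ncard - S.ncard := by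
    rw [← Set.ncard_coe_finset, hY, Set.ncard_sdiff hS hSf]
  rw [← hYc, ← card_powersetCard, ← Set.ncard_coe_finset]
  have hmem : ∀ e ∈ {e | e ∈ H.edgeSet ∧ S ⊆ e}, e \ S ∈
      (fun A : Finset α => (A : Set α)) '' (powersetCard (k - S.ncard) Y : Finset (Finset α)) := by
    rintro e ⟨he, hSe⟩
    have heV := H.subset_vertexSet_of_mem_edgeSet' he
    obtain ⟨A, hA⟩ := ((hH.1.subset heV).sdiff (t := S)).exists_finset_coe
    refine ⟨A, ?_, hA⟩
    rw [mem_coe, mem_powersetCard, ← coe_subset, hA, hY]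
    refine ⟨Set.sdiff_subset_sdiff_left heV, ?_⟩
    rw [← Set.ncard_coe_finset, hA, Set.ncard_sdiff hSe hSf, hH.2 e he]
  refine (Set.ncard_le_ncard_of_injOn (fun e => e \ S) hmem ?_
    ((Finset.finite_toSet _).image _)).trans (Set.ncard_image_le (Finset.finite_toSet _))
  rintro e ⟨-, he⟩ e' ⟨-, he'⟩ h
  have h' : e \ S = e' \ S := h
  rw [← Set.sdiff_union_of_subset he, h', Set.sdiff_union_of_subset he']

/-- The bound on `ℓ` excludes the infimum over the empty set, whose value 0 need not be attained. -/
lemma exists_setDegree_eq_minDegree {ℓ : ℕ} {H : Hypergraph α}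
    (hℓ : ℓ ≤ H.vertexSet.ncard) :
    ∃ S ⊆ H.vertexSet, S.ncard = ℓ ∧ H.setDegree S = H.minDegree ℓ := by
  obtain ⟨T, hT, hTc⟩ := Set.exists_subset_card_eq hℓ
  obtain ⟨S, hS, h⟩ := Nat.sInf_mem
    (⟨_, T, ⟨hT, hTc⟩, rfl⟩ : (H.setDegree '' {S | S ⊆ H.vertexSet ∧ S.ncard = ℓ}).Nonempty)
  exact ⟨S, hS.1, hS.2, h⟩

lemma minDegree_le_setDegree {ℓ : ℕ} {H : Hypergraph α} {S : Set α} (hS : S ⊆ H.vertexSet)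
    (hSc : S.ncard = ℓ) : H.minDegree ℓ ≤ H.setDegree S :=
  Nat.sInf_le ⟨S, ⟨hS, hSc⟩, rfl⟩

lemma IsKGraph.minDegree_le {k ℓ : ℕ} {H : Hypergraph α} (hH : H.IsKGraph k)
    (hℓ : ℓ ≤ H.vertexSet.ncard) : H.minDegree ℓ ≤ (H.vertexSet.ncard - ℓ).choose (k - ℓ) := by
  obtain ⟨S, hS, hSc, h⟩ := exists_setDegree_eq_minDegree hℓ
  rw [← h, ← hSc]
  exact hH.setDegree_le hS

lemma IsKGraph.induce {k : ℕ} {H : Hypergraph α} (hH : H.IsKGraph k) (S : Set α) :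
    (H.induce S).IsKGraph k :=
  ⟨hH.1.subset Set.inter_subset_left, fun e he => hH.2 e he.1⟩

/-- Deleting few vertices reduces the minimum degree only slightly. -/
lemma IsKGraph.minDegree_le_induce {k ℓ : ℕ} {H : Hypergraph α} (hH : H.IsKGraph k)
    (Z : Finset α) (hZ : (Z : Set α) ⊆ H.vertexSet)
    (hℓ : ℓ ≤ (H.induce (H.vertexSet \ Z)).vertexSet.ncard) :
    H.minDegree ℓ ≤ (H.induce (H.vertexSet \ Z)).minDegree ℓ +
      #Z * (H.vertexSet.ncard - (ℓ + 1)).choose (k - (ℓ + 1)) := by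
  classical
  obtain ⟨S, hS, hSc, h⟩ := exists_setDegree_eq_minDegree hℓ
  have hS' : S ⊆ H.vertexSet \ Z := hS.trans Set.inter_subset_right
  have hSf : S.Finite := hH.1.subset (hS'.trans Set.sdiff_subset)
  rw [← h]
  refine (minDegree_le_setDegree (hS'.trans Set.sdiff_subset) hSc).trans ?_
  have hfin : H.edgeSet.Finite := hH.1.powerset.subset H.subset_vertexSet_of_mem_edgeSet'
  -- An edge on `S` lost by the deletion contains `S` and some `z` in `Z`, so it is counted in the
  -- degree of an `(ℓ + 1)`-set.
  have hsub : {e | e ∈ H.edgeSet ∧ S ⊆ e} ⊆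
      {e | e ∈ (H.induce (H.vertexSet \ Z)).edgeSet ∧ S ⊆ e} ∪
        ⋃ z ∈ Z, {e | e ∈ H.edgeSet ∧ insert z S ⊆ e} := by
    rintro e ⟨he, hSe⟩
    by_cases hd : Disjoint e (Z : Set α)
    · exact Or.inl ⟨⟨he, Set.subset_sdiff.2 ⟨H.subset_vertexSet_of_mem_edgeSet' he, hd⟩⟩, hSe⟩
    · obtain ⟨z, hze, hzZ⟩ := Set.not_disjoint_iff.1 hd
      refine Or.inr ?_
      simp only [Set.mem_iUnion, exists_prop]
      exact ⟨z, hzZ, he, Set.insert_subset hze hSe⟩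
  have hfinU : (⋃ z ∈ Z, {e | e ∈ H.edgeSet ∧ insert z S ⊆ e}).Finite :=
    hfin.subset (Set.iUnion₂_subset fun z _ e he => he.1)
  refine (Set.ncard_le_ncard hsub ((hfin.subset fun e he => he.1.1).union hfinU)).trans
    ((Set.ncard_union_le _ _).trans (Nat.add_le_add_left ?_ _))
  refine (Finset.set_ncard_biUnion_le Z _).trans (sum_le_card_nsmul Z _ _ fun z hz => ?_)
  have hzS : z ∉ S := fun h => (hS' h).2 hz
  have := hH.setDegree_le (Set.insert_subset (hZ hz) (hS'.trans Set.sdiff_subset))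
  rw [Set.ncard_insert_of_notMem hzS hSf, hSc] at this
  exact this

lemma setDegree_image {K : Hypergraph γ} {f : γ → α} (hf : Function.Injective f) (S : Set γ) :
    (K.image f).setDegree (f '' S) = K.setDegree S := by
  have : {e | e ∈ (K.image f).edgeSet ∧ f '' S ⊆ e} =
      (fun e => f '' e) '' {e | e ∈ K.edgeSet ∧ S ⊆ e} := by
    ext e
    constructor
    · rintro ⟨⟨e, he, rfl⟩, hS⟩
      exact ⟨e, ⟨he, (Set.image_subset_image_iff hf).1 hS⟩, rfl⟩
    · rintro ⟨e, ⟨he, hS⟩, rfl⟩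
      exact ⟨⟨e, he, rfl⟩, Set.image_mono hS⟩
  rw [setDegree, this, Set.ncard_image_of_injective _ hf.image_injective, setDegree]

lemma minDegree_image_le {ℓ : ℕ} {K : Hypergraph γ} {f : γ → α} (hf : Function.Injective f)
    (hℓ : ℓ ≤ K.vertexSet.ncard) :
    (K.image f).minDegree ℓ ≤ K.minDegree ℓ := by
  obtain ⟨S, hS, hSc, h⟩ := exists_setDegree_eq_minDegree hℓ
  rw [← h, ← setDegree_image hf]
  exact minDegree_le_setDegree (Set.image_mono hS) (by rw [Set.ncard_image_of_injective _ hf, hSc])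

lemma IsCopyIn.image {F : Hypergraph β} {K G : Hypergraph γ} {f : γ → α}
    (hf : Function.Injective f) (h : IsCopyIn F K G) : IsCopyIn F (K.image f) (G.image f) := by
  obtain ⟨hv, he, g, hg, rfl⟩ := h
  exact ⟨Set.image_mono hv, Set.image_mono he, f ∘ g, hf.comp_injOn hg, image_image F⟩

/-- Every finite hypergraph is isomorphic to one on `Fin n`. -/
lemma exists_image_fin_eq {H : Hypergraph α} (hH : H.vertexSet.Finite) :
    ∃ (n : ℕ) (f : Fin n → α) (K : Hypergraph (Fin n)),
      Function.Injective f ∧ K.image f = H := by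
  have : Finite H.vertexSet := hH
  obtain ⟨e⟩ : Nonempty (Fin H.vertexSet.ncard ≃ H.vertexSet) :=
    ⟨(Finite.equivFin H.vertexSet).symm⟩
  have hr : Set.range (fun i => (e i : α)) = H.vertexSet := by
    ext x
    constructor
    · rintro ⟨i, rfl⟩
      exact (e i).2
    · intro hx
      exact ⟨e.symm ⟨x, hx⟩, by simp⟩
  refine ⟨_, fun i => e i, ⟨Set.univ, {s | (fun i => (e i : α)) '' s ∈ H.edgeSet}, by simp⟩,
    fun i j hij => e.injective (Subtype.ext hij), ?_⟩
  ext x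
  · simp only [image_vertexSet, Set.image_univ, hr]
  · constructor
    · rintro ⟨s, hs, rfl⟩
      exact hs
    · intro hx
      have h1 : (fun i => (e i : α)) '' ((fun i => (e i : α)) ⁻¹' x) = x := by
        rw [Set.image_preimage_eq_inter_range, hr]
        exact Set.inter_eq_left.2 (H.subset_vertexSet_of_mem_edgeSet' hx)
      exact ⟨_, by rw [Set.mem_ofPred_eq, h1]; exact hx, h1⟩

open scoped Classical in
/-- The almost packing property transfers from hypergraphs in `Type` to all universes. -/
lemma exists_almostPacking_of_forall_type {k : ℕ} {F : Hypergraph β} {ℓ D n₀ : ℕ} {δ : ℝ}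
    (hδ : ∀ (γ : Type) (K : Hypergraph γ), K.IsKGraph k → n₀ ≤ K.vertexSet.ncard →
      δ * ((K.vertexSet.ncard - ℓ).choose (k - ℓ) : ℝ) ≤ (K.minDegree ℓ : ℝ) →
      ∃ M : Finset (Hypergraph γ), IsPacking F K M ∧ (K.vertexSet \ covered M).ncard ≤ D)
    {H : Hypergraph α} (hH : H.IsKGraph k) (hn : n₀ ≤ H.vertexSet.ncard)
    (hℓ : ℓ ≤ H.vertexSet.ncard)
    (hdeg : δ * ((H.vertexSet.ncard - ℓ).choose (k - ℓ) : ℝ) ≤ (H.minDegree ℓ : ℝ)) :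
    ∃ M : Finset (Hypergraph α), IsPacking F H M ∧ (H.vertexSet \ covered M).ncard ≤ D := by
  obtain ⟨n, f, K, hf, rfl⟩ := exists_image_fin_eq hH.1
  have hKn : K.vertexSet.ncard = (K.image f).vertexSet.ncard := by
    rw [image_vertexSet, Set.ncard_image_of_injective _ hf]
  have hKk : K.IsKGraph k := by
    refine ⟨Set.toFinite _, fun e he => ?_⟩
    rw [← Set.ncard_image_of_injective e hf]
    exact hH.2 _ ⟨e, he, rfl⟩
  obtain ⟨M, hM, hMD⟩ := hδ _ K hKk (by rw [hKn]; exact hn) (by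
    rw [hKn]
    refine hdeg.trans ?_
    exact_mod_cast minDegree_image_le hf (hKn ▸ hℓ))
  have hcov : covered (M.image (fun G => G.image f)) = f '' covered M := by
    simp only [covered, Finset.mem_image, Set.iUnion_exists, Set.biUnion_and', Set.iUnion_iUnion_eq_right,
      image_vertexSet, Set.image_iUnion]
  refine ⟨M.image (fun G => G.image f), ⟨?_, ?_⟩, ?_⟩
  · intro G hG
    obtain ⟨G, hG₁, rfl⟩ := Finset.mem_image.1 hG
    exact (hM.1 G hG₁).image hf
  · intro G hG G' hG' hne
    obtain ⟨G, hG₁, rfl⟩ := Finset.mem_image.1 (mem_coe.1 hG)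
    obtain ⟨G', hG₁', rfl⟩ := Finset.mem_image.1 (mem_coe.1 hG')
    exact (Set.disjoint_image_iff hf).2 (hM.2 hG₁ hG₁' (fun h => hne (h ▸ rfl)))
  · rw [hcov, image_vertexSet, ← Set.image_sdiff hf, Set.ncard_image_of_injective _ hf]
    exact hMD

lemma almostPackingThreshold_nonneg (k : ℕ) (F : Hypergraph β) (ℓ D : ℕ) :
    0 ≤ almostPackingThreshold k F ℓ D :=
  Real.sInf_nonneg fun _ h => h.1

/-- Above the threshold, almost perfect packings exist. -/
lemma exists_forall_almostPacking {k : ℕ} (F : Hypergraph β) {ℓ : ℕ} (hℓ : ℓ < k) (D : ℕ)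
    {ε : ℝ} (hε : 0 < ε) :
    ∃ n₀ : ℕ, ∀ (γ : Type) (K : Hypergraph γ), K.IsKGraph k → n₀ ≤ K.vertexSet.ncard →
      (almostPackingThreshold k F ℓ D + ε) * ((K.vertexSet.ncard - ℓ).choose (k - ℓ) : ℝ) ≤
        (K.minDegree ℓ : ℝ) →
      ∃ M : Finset (Hypergraph γ), IsPacking F K M ∧ (K.vertexSet \ covered M).ncard ≤ D := by
  have hne : {δ : ℝ | 0 ≤ δ ∧ ForcesAlmostPacking k F ℓ D δ}.Nonempty := by
    -- The value 1 is admissible vacuously: no degree exceeds the full binomial coefficient.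
    refine ⟨1, zero_le_one, fun ε hε => ⟨k, fun γ K hK hn hdeg => ?_⟩⟩
    have h1 : (K.minDegree ℓ : ℝ) ≤ ((K.vertexSet.ncard - ℓ).choose (k - ℓ) : ℝ) := by
      exact_mod_cast hK.minDegree_le (by omega)
    have h2 : (0 : ℝ) < ((K.vertexSet.ncard - ℓ).choose (k - ℓ) : ℝ) := by
      exact_mod_cast Nat.choose_pos (by omega)
    nlinarith
  obtain ⟨δ, ⟨-, hδ⟩, hlt⟩ := exists_lt_of_csInf_lt hne
    (show sInf {δ : ℝ | 0 ≤ δ ∧ ForcesAlmostPacking k F ℓ D δ} <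
      almostPackingThreshold k F ℓ D + ε from lt_add_of_pos_right _ hε)
  -- An admissible `δ` slightly above the infimum suffices, with the remaining gap as its error
  -- term.
  obtain ⟨n₀, hn₀⟩ := hδ (almostPackingThreshold k F ℓ D + ε - δ) (by linarith)
  refine ⟨n₀, fun γ K hK hn hdeg => hn₀ γ K hK hn ?_⟩
  rwa [add_sub_cancel]

instance (m : ℕ) : Finite (Hypergraph (Fin m)) :=
  Finite.of_injective (fun F => (F.vertexSet, F.edgeSet)) fun _ _ h =>
    Hypergraph.ext (congrArg Prod.fst h) (congrArg Prod.snd h)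

open Filter in
/-- Above the threshold, almost perfect packings exist, uniformly for all hypergraphs on `m`
vertices. -/
lemma exists_uniform_almostPacking_fin (m D : ℕ) {ε : ℝ} (hε : 0 < ε) :
    ∃ n₀ : ℕ, ∀ k ≤ m, ∀ ℓ < k, ∀ (F : Hypergraph (Fin m)) (γ : Type) (K : Hypergraph γ),
      K.IsKGraph k → n₀ ≤ K.vertexSet.ncard →
      (almostPackingThreshold k F ℓ D + ε) * ((K.vertexSet.ncard - ℓ).choose (k - ℓ) : ℝ) ≤
        (K.minDegree ℓ : ℝ) →
      ∃ M : Finset (Hypergraph γ), IsPacking F K M ∧ (K.vertexSet \ covered M).ncard ≤ D := by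
  -- The theorem fixes `n₀` before `k`, `ℓ` and `F`. With `k ≤ m` and `F` on `Fin m` there are
  -- finitely many cases.
  have key : ∀ᶠ n₀ : ℕ in atTop, ∀ k ∈ Set.Iic m, ∀ ℓ ∈ Set.Iio k, ∀ F ∈ (Set.univ : Set (Hypergraph (Fin m))),
      ∀ (γ : Type) (K : Hypergraph γ), K.IsKGraph k → n₀ ≤ K.vertexSet.ncard →
      (almostPackingThreshold k F ℓ D + ε) * ((K.vertexSet.ncard - ℓ).choose (k - ℓ) : ℝ) ≤
        (K.minDegree ℓ : ℝ) →
      ∃ M : Finset (Hypergraph γ), IsPacking F K M ∧ (K.vertexSet \ covered M).ncard ≤ D := by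
    refine (eventually_all_finite (Set.finite_Iic m)).2 fun k _ => ?_
    refine (eventually_all_finite (Set.finite_Iio k)).2 fun ℓ hℓ => ?_
    refine (eventually_all_finite Set.finite_univ).2 fun F _ => ?_
    obtain ⟨n₀, hn₀⟩ := exists_forall_almostPacking F hℓ D hε
    filter_upwards [eventually_ge_atTop n₀] with n hn γ K hK hnK
    exact hn₀ γ K hK (hn.trans hnK)
  obtain ⟨n₀, hn₀⟩ := key.exists
  exact ⟨n₀, fun k hk ℓ hℓ F => hn₀ k hk ℓ hℓ F (Set.mem_univ F)⟩

lemma isPacking_image_iff {F : Hypergraph β} {g : β → γ} (hg : Set.InjOn g F.vertexSet)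
    (hF : F.vertexSet.Nonempty) (H : Hypergraph α) (M : Finset (Hypergraph α)) :
    IsPacking (F.image g) H M ↔ IsPacking F H M := by
  simp only [IsPacking, isCopyIn_image_iff hg hF]

/-- The threshold sees only the isomorphism class of `F`, so `F` can be moved to `Fin m`. -/
lemma almostPackingThreshold_image {F : Hypergraph β} {g : β → γ} (hg : Set.InjOn g F.vertexSet)
    (hF : F.vertexSet.Nonempty) (k ℓ D : ℕ) :
    almostPackingThreshold k (F.image g) ℓ D = almostPackingThreshold k F ℓ D := by
  simp only [almostPackingThreshold, ForcesAlmostPacking, isPacking_image_iff hg hF]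

lemma exists_injOn_fin {F : Hypergraph β} {m : ℕ} (hm : 1 ≤ m) (hF : F.vertexSet.ncard = m) :
    ∃ g : β → Fin m, Set.InjOn g F.vertexSet := by
  have hfin : F.vertexSet.Finite := Set.finite_of_ncard_pos (by omega)
  have : Nonempty (Fin m) := ⟨⟨0, hm⟩⟩
  obtain ⟨g, -, hg⟩ := Set.Finite.exists_injOn_of_encard_le hfin (t := (Set.univ : Set (Fin m))) (by
    rw [← hfin.cast_ncard_eq, hF, Set.encard_univ]
    simp)
  exact ⟨g, hg⟩

end Hypergraph

/-! ### Vertex deletion, edgeless `F`, and colourings -/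

namespace Hypergraph

variable {α β γ : Type*}

open scoped Classical in
/-- After deleting few vertices, almost perfect packings still exist. -/
lemma exists_almostPacking_sdiff {k ℓ D n₀ m : ℕ} {F : Hypergraph β} {δ ε θ : ℝ} (hℓ : ℓ < k)
    (hk : k ≤ m) (hδ0 : 0 ≤ δ) (hε : 0 < ε) (hF : F.vertexSet.Finite)
    (hδ : ∀ (γ : Type) (K : Hypergraph γ), K.IsKGraph k → n₀ ≤ K.vertexSet.ncard →
      (δ + ε / 2) * ((K.vertexSet.ncard - ℓ).choose (k - ℓ) : ℝ) ≤ (K.minDegree ℓ : ℝ) →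
      ∃ M : Finset (Hypergraph γ), IsPacking F K M ∧ (K.vertexSet \ covered M).ncard ≤ D)
    {H : Hypergraph α} (hH : H.IsKGraph k) {X : Finset α} (hX : (X : Set α) = H.vertexSet)
    (hn : 2 * n₀ ≤ #X) (hnm : 2 * m ≤ #X)
    (hdeg : (δ + ε) * ((H.vertexSet.ncard - ℓ).choose (k - ℓ) : ℝ) ≤ (H.minDegree ℓ : ℝ))
    (hθ : θ ≤ 1 / 2) (hθε : 4 * (θ * m) ≤ ε) (Z : Finset α) (hZX : Z ⊆ X)
    (hZ : (#Z : ℝ) ≤ θ * #X) :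
    ∃ M : Finset (Finset α), (∀ A ∈ M, A ∈ copySets F H) ∧
      (M : Set (Finset α)).PairwiseDisjoint id ∧ M.biUnion id ⊆ X \ Z ∧
      #((X \ Z) \ M.biUnion id) ≤ D := by
  have hHn : H.vertexSet.ncard = #X := by rw [← hX, Set.ncard_coe_finset]
  have hX' : (((X \ Z : Finset α)) : Set α) = (H.induce (H.vertexSet \ Z)).vertexSet := by
    rw [coe_sdiff, hX]
    exact (Set.inter_eq_right.2 Set.sdiff_subset).symm
  have hn' : (H.induce (H.vertexSet \ Z)).vertexSet.ncard = #(X \ Z) := by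
    rw [← hX', Set.ncard_coe_finset]
  have hc : #(X \ Z) + #Z = #X := card_sdiff_add_card_eq_card hZX
  have hZ2 : 2 * #Z ≤ #X := by
    have h1 : (2 : ℝ) * #Z ≤ #X := by nlinarith [Nat.cast_nonneg (α := ℝ) #X]
    exact_mod_cast h1
  have hℓn : ℓ ≤ (H.induce (H.vertexSet \ Z)).vertexSet.ncard := by omega
  obtain ⟨M, hM, hMD⟩ := exists_almostPacking_of_forall_type (n₀ := n₀) hδ
    (hH.induce (H.vertexSet \ Z)) (by omega) hℓn (by
      have h1 := hH.minDegree_le_induce Z (by rw [← hX]; exact_mod_cast hZX) hℓn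
      rw [hn']
      rw [hHn] at h1 hdeg
      set a : ℕ := (#X - (ℓ + 1)).choose (k - (ℓ + 1)) with ha
      set C : ℕ := (#X - ℓ).choose (k - ℓ) with hCdef
      -- With `#X ≤ 2 * (#X - ℓ)`, this bounds the degree loss `#Z * a` by `2 * θ * m * C`, hence by
      -- half of the slack `ε * C`.
      have h2 : (#X - ℓ) * a = C * (k - ℓ) := by
        have := Nat.add_one_mul_choose_eq (#X - (ℓ + 1)) (k - (ℓ + 1))
        rwa [show #X - (ℓ + 1) + 1 = #X - ℓ by omega,
          show k - (ℓ + 1) + 1 = k - ℓ by omega] at this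
      have h3 : #X * a ≤ 2 * (C * m) := by
        calc #X * a ≤ 2 * (#X - ℓ) * a := Nat.mul_le_mul_right _ (by omega)
          _ = 2 * (C * (k - ℓ)) := by rw [mul_assoc, h2]
          _ ≤ 2 * (C * m) :=
            Nat.mul_le_mul_left _ (Nat.mul_le_mul_left _ (by omega))
      have h3' : (#X : ℝ) * a ≤ 2 * (C * m) := by exact_mod_cast h3
      have h4 : (#(X \ Z) - ℓ).choose (k - ℓ) ≤ C := Nat.choose_le_choose _ (by omega)
      have h4' : ((#(X \ Z) - ℓ).choose (k - ℓ) : ℝ) ≤ C := by exact_mod_cast h4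
      have h1' : (H.minDegree ℓ : ℝ) ≤ (H.induce (H.vertexSet \ Z)).minDegree ℓ + #Z * a := by
        exact_mod_cast h1
      have hθ0 : 0 ≤ θ ∨ (#Z : ℝ) * a ≤ 0 := by
        by_contra! hcon
        have : (#Z : ℝ) ≤ 0 := hZ.trans
          (mul_nonpos_of_nonpos_of_nonneg hcon.1.le (Nat.cast_nonneg _))
        nlinarith [Nat.cast_nonneg (α := ℝ) a]
      have h5 : (#Z : ℝ) * a ≤ ε / 2 * C := by
        have hC0 : (0 : ℝ) ≤ C := Nat.cast_nonneg _
        rcases hθ0 with hθ0 | h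
        · calc (#Z : ℝ) * a ≤ θ * #X * a := by gcongr
            _ = θ * (#X * a) := by ring
            _ ≤ θ * (2 * (C * m)) := by gcongr
            _ = 4 * (θ * m) / 2 * C := by ring
            _ ≤ ε / 2 * C := by gcongr
        · exact h.trans (by positivity)
      calc (δ + ε / 2) * ((#(X \ Z) - ℓ).choose (k - ℓ) : ℝ) ≤ (δ + ε / 2) * C := by gcongr
        _ ≤ _ := by linarith)
  obtain ⟨N, hN, hNd, -, hNc⟩ := hM.exists_finset hF
  refine ⟨N, fun A hA => ?_, hNd, ?_, ?_⟩
  · obtain ⟨G, hG, hGA⟩ := hN A hA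
    exact ⟨G, (isCopyIn_induce_iff.1 hG).1, hGA⟩
  · rw [biUnion_subset]
    intro A hA
    exact (card_of_mem_copySets hX' (hN A hA)).1
  · rw [← Set.ncard_coe_finset, coe_sdiff, hNc, hX']
    exact hMD

/-- If `F` has no edges, then every set of the right size spans a copy of `F`. -/
lemma mem_copySets_of_edgeSet_eq_empty {F : Hypergraph β} (hFn : F.vertexSet.Nonempty)
    (hFf : F.vertexSet.Finite) (hFe : F.edgeSet = ∅) {H : Hypergraph α} {A : Finset α}
    (hA : (A : Set α) ⊆ H.vertexSet) (hAc : #A = F.vertexSet.ncard) : A ∈ copySets F H := by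
  have hne : A.Nonempty := by
    rw [← card_pos, hAc]
    exact (Set.ncard_pos hFf).2 hFn
  have : Nonempty α := ⟨hne.choose⟩
  obtain ⟨f, hf⟩ := hFf.exists_bijOn_of_encard_eq (t := (A : Set α)) (by
    rw [Set.encard_coe_eq_coe_finsetCard, hAc, hFf.cast_ncard_eq])
  refine ⟨F.image f, ⟨?_, ?_, f, hf.injOn, rfl⟩, hf.image_eq⟩
  · rw [image_vertexSet, hf.image_eq]
    exact hA
  · rw [image_edgeSet, hFe, Set.image_empty]
    exact Set.empty_subset _

/-- Almost perfect packings above the threshold, uniformly in `k`, `ℓ` and `F`. -/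
lemma exists_uniform_almostPacking (m D : ℕ) (hm : 1 ≤ m) {ε : ℝ} (hε : 0 < ε) :
    ∃ n₀ : ℕ, ∀ k ≤ m, ∀ ℓ < k, ∀ (W : Type*) (F : Hypergraph W), F.vertexSet.ncard = m →
      ∀ (γ : Type) (K : Hypergraph γ), K.IsKGraph k → n₀ ≤ K.vertexSet.ncard →
      (almostPackingThreshold k F ℓ D + ε) * ((K.vertexSet.ncard - ℓ).choose (k - ℓ) : ℝ) ≤
        (K.minDegree ℓ : ℝ) →
      ∃ M : Finset (Hypergraph γ), IsPacking F K M ∧ (K.vertexSet \ covered M).ncard ≤ D := by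
  obtain ⟨n₀, hn₀⟩ := exists_uniform_almostPacking_fin m D hε
  refine ⟨n₀, fun k hk ℓ hℓ W F hF γ K hK hn hdeg => ?_⟩
  obtain ⟨g, hg⟩ := exists_injOn_fin hm hF
  have hFn : F.vertexSet.Nonempty := Set.nonempty_of_ncard_ne_zero (by omega)
  rw [← almostPackingThreshold_image hg hFn] at hdeg
  obtain ⟨M, hM, hMD⟩ := hn₀ k hk ℓ hℓ (F.image g) γ K hK hn hdeg
  exact ⟨M, (isPacking_image_iff hg hFn K M).1 hM, hMD⟩

/-- The colouring of the vertices by the parts of an ordered partition. -/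
lemma IsOrderedPartition.exists_colouring {d : ℕ} {P : Fin d → Set α} {X : Finset α}
    (hP : IsOrderedPartition P X) (hd : 0 < d) :
    ∃ col : α → Fin d, ∀ x ∈ X, ∀ i, x ∈ P i ↔ col x = i := by
  have h1 : ∀ x : α, ∃ j : Fin d, x ∈ X → x ∈ P j := by
    intro x
    by_cases hx : x ∈ X
    · have : x ∈ ⋃ i, P i := by rw [hP.2.2]; exact hx
      obtain ⟨j, hj⟩ := Set.mem_iUnion.1 this
      exact ⟨j, fun _ => hj⟩
    · exact ⟨⟨0, hd⟩, fun h => absurd h hx⟩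
  choose col hcol using h1
  refine ⟨col, fun x hx i => ⟨fun hi => ?_, fun hi => hi ▸ hcol x hx⟩⟩
  by_contra hne
  exact Set.disjoint_left.1 (hP.2.1 hne) (hcol x hx) hi

-- Bounds the number of parts by `1 / c`, so that constants can be chosen before the partition.
open scoped Classical in
lemma IsOrderedPartition.card_mul_le {d : ℕ} {P : Fin d → Set α} {X : Finset α}
    (hP : IsOrderedPartition P X) {c : ℝ} (hX : X.Nonempty)
    (hc : ∀ i, c * (#X : ℝ) ≤ ((P i).ncard : ℝ)) : d * c ≤ 1 := by
  have hPX : ∀ i, P i ⊆ X := fun i => by rw [← hP.2.2]; exact Set.subset_iUnion P i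
  have h1 : ∑ i, (P i).ncard ≤ #X := by
    have h2 : ∀ i, ∃ A : Finset α, (A : Set α) = P i := fun i =>
      (X.finite_toSet.subset (hPX i)).exists_finset_coe
    choose A hA using h2
    simp only [← hA, Set.ncard_coe_finset]
    rw [← card_biUnion fun i _ j _ hij => by
      simp only [Function.onFun]
      rw [← disjoint_coe, hA, hA]
      exact hP.2.1 hij]
    refine card_le_card (biUnion_subset.2 fun i _ => ?_)
    rw [← coe_subset, hA]
    exact hPX i
  have h3 : (d : ℝ) * (c * #X) ≤ ∑ i, ((P i).ncard : ℝ) := by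
    simpa using card_nsmul_le_sum univ (fun i => ((P i).ncard : ℝ)) _ fun i _ => hc i
  have h4 : ∑ i, ((P i).ncard : ℝ) ≤ #X := by exact_mod_cast h1
  have hXpos : (0 : ℝ) < #X := by exact_mod_cast hX.card_pos
  nlinarith

open scoped Classical in
lemma isSoluble_iff {d : ℕ} {F : Hypergraph β} {H : Hypergraph α} {X : Finset α}
    {P : Fin d → Set α} {col : α → Fin d} (hF : F.vertexSet.Finite)
    (hX : (X : Set α) = H.vertexSet) (hcol : ∀ x ∈ X, ∀ i, x ∈ P i ↔ col x = i)
    (L : AddSubgroup (Fin d → ℤ)) (q : ℕ) :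
    IsSoluble F H P L q ↔ ∃ N : Finset (Finset α), (∀ A ∈ N, A ∈ copySets F H) ∧
      (N : Set (Finset α)).PairwiseDisjoint id ∧ #N ≤ q ∧
      SetPacking.idx col (X \ N.biUnion id) ∈ L := by
  constructor
  · rintro ⟨M, hM, hMq, hML⟩
    obtain ⟨N, hN, hNd, hNM, hNc⟩ := hM.exists_finset hF
    refine ⟨N, hN, hNd, hNM.trans hMq, ?_⟩
    rwa [← indexVector_coe hcol sdiff_subset, coe_sdiff, hX, hNc]
  · rintro ⟨N, hN, hNd, hNq, hNL⟩
    obtain ⟨M, hM, hMN, hMc⟩ := exists_isPacking hN hNd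
    refine ⟨M, hM, hMN.trans hNq, ?_⟩
    rwa [← indexVector_coe hcol sdiff_subset, coe_sdiff, hX, ← hMc] at hNL

end Hypergraph

/-! ### Choice of constants and proof of the theorem -/

open Hypergraph SetPacking in
open scoped Classical in
theorem theorem3p1 (m D q t : ℕ) (hm : 1 ≤ m) (hD : 1 ≤ D) (hq : 1 ≤ q) (ht : 1 ≤ t)
    (γ c : ℝ) (hγ : 0 < γ) (hc : 0 < c) :
    ∃ ε₀ : ℝ, 0 < ε₀ ∧ ∀ b μ : ℝ, 0 < b → b ≤ ε₀ → 0 < μ → μ ≤ ε₀ →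
      ∃ n₀ : ℕ, ∀ (k ℓ : ℕ), ℓ < k →
        ∀ (W : Type*) (F : Hypergraph W), F.IsKGraph k → F.vertexSet.ncard = m →
        ∀ (V : Type*) (H : Hypergraph V), H.IsKGraph k → n₀ ≤ H.vertexSet.ncard →
          m ∣ H.vertexSet.ncard →
          (Hypergraph.almostPackingThreshold k F ℓ D + γ) *
              ((H.vertexSet.ncard - ℓ).choose (k - ℓ) : ℝ) ≤ (H.minDegree ℓ : ℝ) →
          ∀ (d : ℕ) (P : Fin d → Set V), Hypergraph.IsGoodPartition F H b t c P →
            ENat.card (Hypergraph.CosetGroup m (Hypergraph.robustLattice F H P μ)) ≤ (q : ℕ∞) →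
            (Hypergraph.HasPerfectPacking F H ↔
              Hypergraph.IsSoluble F H P (Hypergraph.robustLattice F H P μ) q) := by
  -- The constants sensitive to `b` and `μ` are chosen after them, so 1 serves as `ε₀`.
  refine ⟨1, one_pos, fun b μ hb _ hμ _ => ?_⟩
  obtain ⟨e, he⟩ := exists_nat_ge (1 / c)
  obtain ⟨c₀, hc₀⟩ := exists_lists_length_le e m (D + q * m)
  obtain ⟨n₁, hn₁⟩ := exists_uniform_almostPacking m D hm (half_pos hγ)
  -- `θ n` is the number of vertices that may be set aside. In order, the bounds keep half of the
  -- vertices, half of the reachable sets, a copy of each robust index vector, and enough minimum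
  -- degree.
  obtain ⟨θ, hθ, hθ1, hθb, hθμ, hθγ⟩ : ∃ θ : ℝ, 0 < θ ∧ θ ≤ 1 / 2 ∧ 2 * θ ≤ b ∧
      θ * 2 ^ 2 ^ m < μ ∧ 4 * (θ * m) ≤ γ := by
    have hm' : (0 : ℝ) < m := by exact_mod_cast hm
    have h1 : (0 : ℝ) < 2 ^ 2 ^ m := by positivity
    refine ⟨min (min (1 / 2) (b / 2)) (min (μ / (2 * 2 ^ 2 ^ m)) (γ / (4 * m))), by positivity,
      (min_le_left _ _).trans (min_le_left _ _), ?_, ?_, ?_⟩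
    · have := (min_le_left (min (1 / 2) (b / 2)) (min (μ / (2 * 2 ^ 2 ^ m)) (γ / (4 * m)))).trans
        (min_le_right _ _)
      linarith
    · have := (min_le_right (min (1 / 2) (b / 2)) (min (μ / (2 * 2 ^ 2 ^ m)) (γ / (4 * m)))).trans
        (min_le_left _ _)
      rw [le_div_iff₀ (by positivity)] at this
      linarith
    · have := (min_le_right (min (1 / 2) (b / 2)) (min (μ / (2 * 2 ^ 2 ^ m)) (γ / (4 * m)))).trans
        (min_le_right _ _)
      rw [le_div_iff₀ (by positivity)] at this
      linarith
  set s := t * m - 1 with hs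
  set η : ℝ := θ ^ (m * c₀) / (((D + q * m : ℕ) : ℝ) + 1) ^ e with hη
  have hη0 : 0 < η := by positivity
  have hη1 : η ≤ 1 := by
    have h1 : (1 : ℝ) ≤ ((D + q * m : ℕ) : ℝ) + 1 := by
      linarith [Nat.cast_nonneg (α := ℝ) (D + q * m)]
    exact div_le_one_of_le₀ ((pow_le_one₀ hθ.le (by linarith)).trans (one_le_pow₀ h1))
      (by positivity)
  obtain ⟨n₂, hn₂⟩ := Filter.eventually_atTop.1 (eventually_exists_steps (ρ := 1 - η) (θ := θ)
    (by linarith) (by linarith) hθ (D + q * m) (q * m) (q + 1) (2 * (m * c₀) + m * c₀ * s))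
  -- Ensures that every part has at least two vertices.
  obtain ⟨n₃, hn₃⟩ := exists_nat_ge (2 / c)
  refine ⟨max (max (2 * n₁) (2 * m)) (max n₂ n₃), ?_⟩
  intro k ℓ hℓ W F hF hFm V H hH hn hmn hdeg d P hP hQ
  obtain ⟨X, hX⟩ := hH.1.exists_finset_coe
  have hHn : H.vertexSet.ncard = #X := by rw [← hX, Set.ncard_coe_finset]
  rw [hHn] at hn hmn
  simp only [max_le_iff] at hn
  obtain ⟨⟨hn1, hn2⟩, hn3, hn4⟩ := hn
  have hXne : X.Nonempty := card_pos.1 (by omega)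
  have hFne : F.vertexSet.Nonempty := Set.nonempty_of_ncard_ne_zero (by omega)
  obtain ⟨hPp, hPr, hPc⟩ := hP
  rw [← hX] at hPp
  rw [hHn] at hPc
  have hd : 0 < d := by
    rcases Nat.eq_zero_or_pos d with rfl | h
    · obtain ⟨x, hx⟩ := hXne
      have : x ∈ ⋃ i, P i := by rw [hPp.2.2]; exact hx
      obtain ⟨i, -⟩ := Set.mem_iUnion.1 this
      exact i.elim0
    · exact h
  obtain ⟨col, hcol⟩ := hPp.exists_colouring hd
  have hC : ∀ A ∈ copySets F H, A ⊆ X ∧ #A = m := fun A hA => hFm ▸ card_of_mem_copySets hX hA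
  have hgrp := exists_sum_sub_mem_of_card_le (col := col) (fun A hA => (hC A hA).2) hQ
  rw [hasPerfectPacking_iff hF.1 hX, isSoluble_iff hF.1 hX hcol]
  refine ⟨fun h => exists_solution_of_packable hgrp h, ?_⟩
  rintro ⟨M₁, hM₁, hM₁d, hM₁q, hM₁L⟩
  -- Uniformity was obtained only for `k ≤ m`; for larger `k` the graph `F` has no edges.
  rcases lt_or_ge m k with hmk | hkm
  · have hFe : F.edgeSet = ∅ := by
      rw [Set.eq_empty_iff_forall_notMem]
      intro a ha
      have h1 := hF.2 a ha
      have h2 := Set.ncard_le_ncard (F.subset_vertexSet_of_mem_edgeSet' ha) hF.1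
      omega
    refine packable_of_forall_card_mem (m := m) (fun A hA hAm => ?_) hmn
    refine mem_copySets_of_edgeSet_eq_empty hFne hF.1 hFe ?_ (hAm.trans hFm.symm)
    rw [← hX]
    exact_mod_cast hA
  obtain ⟨K, hK, hKB⟩ := hn₂ _ hn3
  have hde : d ≤ e := by
    have h1 := hPp.card_mul_le hXne hPc
    have h2 : (d : ℝ) ≤ e := by
      refine le_trans ?_ he
      rwa [le_div_iff₀ hc]
    exact_mod_cast h2
  refine packable_of_solution (m := m) (s := s) (D := D) (q := q) (c := c₀) (e := e) (K := K)
    (θ := θ) (η := η) (I := robustIndexVectors F H P μ) hm hθ (by linarith) hXne hde hη hK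
    (by exact_mod_cast hKB) hC ?_ ?_ ?_ ?_ ?_ hgrp hM₁ hM₁d hM₁q hM₁L
  · intro x hx
    have h1 : (2 : ℝ) ≤ c * #X := by
      have h2 : 2 / c ≤ #X := hn₃.trans (by exact_mod_cast hn4)
      rw [div_le_iff₀ hc] at h2
      linarith
    have h2 : 1 < (P (col x)).ncard := by
      have : (2 : ℝ) ≤ (P (col x)).ncard := h1.trans (hPc _)
      exact_mod_cast this
    obtain ⟨y, hy, hyx⟩ := Set.exists_ne_of_one_lt_ncard h2 x
    have hyX : y ∈ X := by
      have : y ∈ ⋃ i, P i := Set.mem_iUnion.2 ⟨_, hy⟩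
      rw [hPp.2.2] at this
      exact this
    exact ⟨y, hyX, hyx, (hcol y hyX _).1 hy⟩
  · intro x hx y hy hxy hxyc
    have h1 := (hPr (col x) x ((hcol x hx _).2 rfl) y ((hcol y hy _).2 hxyc.symm) hxy).le_card
      hX hF.1 hx hy
    rw [hFm] at h1
    refine le_trans ?_ h1
    gcongr
  · intro v hv Z hZ
    exact exists_copySet_disjoint hX hF.1 hXne hcol (by rw [hFm]; exact hθμ) hv Z hZ
  · refine hc₀ d hde _ fun v hv i => ?_
    have := robustIndexVectors_bounds hF.1 hμ (by rw [hHn]; exact hXne.card_pos) hv i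
    rwa [hFm] at this
  · intro Z hZX hZ
    exact exists_almostPacking_sdiff hℓ hkm (almostPackingThreshold_nonneg k F ℓ D) hγ hF.1
      (hn₁ k hkm ℓ hℓ W F hFm) hH hX hn1 hn2 hdeg hθ1 hθγ Z hZX hZ
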